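/- Let $x_1<\dots<x_k$ ($k\ge 2$) be stress levels, $0=t_0<t_1<\dots<t_L$ inspection times, and $0=\tau_0<\tau_1<\dots<\tau_k$ the times of stress change, with $\tau_i=t_{l_i}$ for $i\ge 1$ and $\tau_k=t_L$; the stress is $x_i$ between $\tau_{i-1}$ and $\tau_i$. For $\theta=(\theta_0,\theta_1)\in\Theta=(0,\infty)\times\mathbb R$ put $\lambda_i=\theta_0e^{\theta_1x_i}$, $a_{i-1}=\lambda_i^{-1}\sum_{l=1}^{i-1}(\tau_l-\tau_{l-1})\lambda_l$ and $a^*_{i-1}=\lambda_i^{-1}\sum_{l=1}^{i-1}\lambda_l(\tau_l-\tau_{l-1})(x_l-x_i)$. The lifetime distribution function of the step-stress (cumulative exposure) model is $G_T(t)=1-e^{-\lambda_i(t+a_{i-1}-\tau_{i-1})}$ and its density is $g_T(t)=\lambda_ie^{-\lambda_i(t+a_{i-1}-\tau_{i-1})}$, for $\tau_{i-1}\le t<\tau_i$, $t>0$ (with $i=k$ for all $t\ge\tau_{k-1}$), and $G_T(t)=0$ for $t\le 0$. Let $\pi(\theta)\in\mathbb R^{L+1}$ have the entries $\pi_j=G_T(t_j)-G_T(t_{j-1})$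 for $j\le L$ and $\pi_{L+1}=1-G_T(t_L)$. Let $W$ be the $(L+1)\times2$ matrix with rows $z_j-z_{j-1}$, where $z_0=z_{L+1}=0$ and, for $1\le j\le L$, with $i$ the stress level in force after time $t_j$ ($i=k$ if $j=L$), $$z_j=g_T(t_j)\begin{pmatrix}(t_j+a_{i-1}-\tau_{i-1})/\theta_0\\ (t_j+a_{i-1}-\tau_{i-1})x_i+a^*_{i-1}\end{pmatrix}.$$ For $\beta\ge0$ let $J_\beta=W^TD_\pi^{\beta-1}W$ and $K_\beta=W^T\big(D_\pi^{2\beta-1}-\pi^\beta(\pi^\beta)^T\big)W$, where $D_\pi$ is the diagonal matrix with entries $\pi_j$ and $\pi^\beta$ has the entries $\pi_j^\beta$. Let the lifetimes $T_1,T_2,\dots$ be independent with distribution function $G_T$ for the true parameter $\theta^0=(\theta^0_0,\theta^0_1)\in\Theta$, and let $\widehat p$ be the vector of the empirical frequencies, among $T_1,\dots,T_N$, of the cells $(t_{j-1},t_j]$, $j\le L$, and $(t_L,\infty)$. Let $\widehat\theta^\beta=\widehat\theta^\beta_N$ be a minimum density power divergence estimator (MDPDE): it minimizes over $\theta\in\Theta$,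 whenever a minimizer exists, the divergence $$d_\beta(\widehat p,\pi(\theta))=\sum_{j=1}^{L+1}\Big(\pi_j(\theta)^{1+\beta}-\big(1+\tfrac1\beta\big)\widehat p_j\,\pi_j(\theta)^\beta+\tfrac1\beta\widehat p_j^{\,\beta+1}\Big)\quad(\beta>0),\qquad d_0(\widehat p,\pi(\theta))=\sum_{j=1}^{L+1}\widehat p_j\log\frac{\widehat p_j}{\pi_j(\theta)}.$$ Let $x_0\in\mathbb R$ be the stress level at normal operating conditions. For $\theta\in\Theta$ the mean of the exponential lifetime with rate $\theta_0e^{\theta_1x_0}$ is $h_2(\theta)=\theta_0^{-1}e^{-\theta_1x_0}$, and $h_2$ has the gradient $$\nabla h_2(\theta)^T=\Big(\frac{-1}{\theta_0^2}e^{-\theta_1x_0},\ \frac{-x_0}{\theta_0}e^{-\theta_1x_0}\Big).$$ Let $\operatorname E_T=h_2(\theta^0)$ and let $\widehat{\operatorname E}_T^\beta=h_2(\widehat\theta^\beta)$ be its plug-in estimator. Then $J_\beta(\theta^0)$ is invertible, and as $N\to\infty$, in distribution, $$\sqrt N\big(\widehat{\operatorname E}_T^\beta-\operatorname E_T\big)\longrightarrow\mathcal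 N\big(0,\sigma(\operatorname E_T)^2\big),\qquad \sigma(\operatorname E_T)^2=\nabla h_2(\theta^0)^TJ_\beta(\theta^0)^{-1}K_\beta(\theta^0)J_\beta(\theta^0)^{-1}\nabla h_2(\theta^0)\ \ge 0 .$$ -/

import Mathlib

namespace StepStress

/-- Two-dimensional parameter vectors `θ = (θ₀, θ₁)`, read as `θ 0` and `θ 1`. -/
abbrev Param : Type := EuclideanSpace ℝ (Fin 2)

/-- The parameter space `Θ = ℝ⁺ × ℝ`. -/
def paramSpace : Set Param := {θ | 0 < θ 0}

/-- The log-linear failure rate `θ₀ exp (θ₁ x)` at stress level `x`. -/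
noncomputable def rate (θ : Param) (x : ℝ) : ℝ := θ 0 * Real.exp (θ 1 * x)

/-- A step-stress plan with `k ≥ 2` increasing stress levels `x 1 < ⋯ < x k` and inspection times
`0 = t 0 < t 1 < ⋯ < t L`. The index `l i` is the number of inspections up to the end of the
`i`-th stress level, so that the `i`-th stress level ends at the inspection time `t (l i)`.
Values of `x`, `l`, `t` at other indices are irrelevant. -/
structure Plan (k L : ℕ) where
  x : ℕ → ℝ
  l : ℕ → ℕ
  t : ℕ → ℝ
  two_le : 2 ≤ k
  x_lt : ∀ i j, 1 ≤ i → i < j → j ≤ k → x i < x j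
  l_zero : l 0 = 0
  l_last : l k = L
  l_lt : ∀ i j, i < j → j ≤ k → l i < l j
  t_zero : t 0 = 0
  t_lt : ∀ i j, i < j → j ≤ L → t i < t j

namespace Plan

variable {k L : ℕ} (P : Plan k L)

/-- The times of stress change `τ 1 < ⋯ < τ k`, with `τ 0 = 0`. -/
def τ (i : ℕ) : ℝ := P.t (P.l i)

/-- The failure rate `λ_i(θ)` at the `i`-th stress level. -/
noncomputable def lam (θ : Param) (i : ℕ) : ℝ := rate θ (P.x i)

/-- The index of the stress level in force immediately after time `s`: it is `i` if
`τ (i-1) ≤ s < τ i`, and it is `k` for all `s ≥ τ (k-1)`. -/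
noncomputable def level (s : ℝ) : ℕ := 1 + ((Finset.Icc 1 (k - 1)).filter (fun i => P.τ i ≤ s)).card

/-- The equivalent exposure `a_{i-1}` with which the `i`-th stress level is entered; it is `0` for
`i = 1`. -/
noncomputable def shift (θ : Param) (i : ℕ) : ℝ :=
  (∑ m ∈ Finset.Icc 1 (i - 1), (P.τ m - P.τ (m - 1)) * P.lam θ m) / P.lam θ i

/-- The quantity `a*_{i-1}`; it is `0` for `i = 1`. -/
noncomputable def shiftStar (θ : Param) (i : ℕ) : ℝ :=
  (1 / P.lam θ i) *
    ∑ m ∈ Finset.Icc 1 (i - 1), P.lam θ m * (P.τ m - P.τ (m - 1)) * (-P.x i + P.x m)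

/-- The shifted time `s + a_{i-1} - τ_{i-1}`, where `i` is the stress level at time `s`. -/
noncomputable def exposure (θ : Param) (s : ℝ) : ℝ :=
  s + P.shift θ (P.level s) - P.τ (P.level s - 1)

/-- The lifetime distribution function `G_T` of the cumulative exposure model. -/
noncomputable def cdf (θ : Param) (s : ℝ) : ℝ :=
  if s ≤ 0 then 0 else 1 - Real.exp (-(P.lam θ (P.level s) * P.exposure θ s))

/-- The lifetime density `g_T`. -/
noncomputable def pdf (θ : Param) (s : ℝ) : ℝ :=
  if s ≤ 0 then 0 else P.lam θ (P.level s) * Real.exp (-(P.lam θ (P.level s) * P.exposure θ s))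

/-- The `L + 1` cells of the experiment. The element `j` of `Fin (L + 1)` stands for the
`(j + 1)`-st cell: `(t j, t (j + 1)]` if `j < L`, and survival beyond `t L` if `j = L`. -/
def cell (j : Fin (L + 1)) : Set ℝ :=
  if (j : ℕ) < L then Set.Ioc (P.t j) (P.t (j + 1)) else Set.Ioi (P.t L)

/-- The vector `π(θ)` of cell probabilities. -/
noncomputable def prob (θ : Param) (j : Fin (L + 1)) : ℝ :=
  if (j : ℕ) < L then P.cdf θ (P.t (j + 1)) - P.cdf θ (P.t j) else 1 - P.cdf θ (P.t L)

/-- The vectors `z_j`, with `z_0 = z_{L+1} = 0`. -/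
noncomputable def z (θ : Param) (j : ℕ) : Fin 2 → ℝ :=
  if 1 ≤ j ∧ j ≤ L then
    P.pdf θ (P.t j) •
      ![P.exposure θ (P.t j) / θ 0,
        P.exposure θ (P.t j) * P.x (P.level (P.t j)) + P.shiftStar θ (P.level (P.t j))]
  else 0

/-- The `(L + 1) × 2` matrix `W` with rows `z_j - z_{j-1}`, `j = 1, …, L + 1`. -/
noncomputable def W (θ : Param) : Matrix (Fin (L + 1)) (Fin 2) ℝ :=
  Matrix.of fun j => P.z θ (j + 1) - P.z θ j

/-- The matrix `J_β(θ) = Wᵀ D^{β-1} W`. -/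
noncomputable def J (β : ℝ) (θ : Param) : Matrix (Fin 2) (Fin 2) ℝ :=
  (P.W θ).transpose * Matrix.diagonal (fun j => P.prob θ j ^ (β - 1)) * P.W θ

/-- The matrix `K_β(θ) = Wᵀ (D^{2β-1} - π^β (π^β)ᵀ) W`. -/
noncomputable def K (β : ℝ) (θ : Param) : Matrix (Fin 2) (Fin 2) ℝ :=
  (P.W θ).transpose *
    (Matrix.diagonal (fun j => P.prob θ j ^ (2 * β - 1)) -
      Matrix.vecMulVec (fun j => P.prob θ j ^ β) (fun j => P.prob θ j ^ β)) * P.W θ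

open Classical in
/-- The empirical probability vector of the first `N` devices, for lifetimes `T 0, T 1, …`. -/
noncomputable def empirical {Ω : Type*} (T : ℕ → Ω → ℝ) (N : ℕ) (ω : Ω) (j : Fin (L + 1)) : ℝ :=
  (((Finset.range N).filter (fun i => T i ω ∈ P.cell j)).card : ℝ) / N

end Plan

/-- The density power divergence with tuning parameter `β` between two probability vectors; for
`β = 0` it is the Kullback-Leibler divergence. -/
noncomputable def dpd {n : ℕ} (β : ℝ) (p q : Fin n → ℝ) : ℝ :=
  if β = 0 then ∑ j, p j * Real.log (p j / q j)
  else ∑ j, (q j ^ (1 + β) - (1 + 1 / β) * p j * q j ^ β + (1 / β) * p j ^ (β + 1))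

/-- `θ` is a minimum density power divergence estimate for the probability vector `p`, that is, a
minimizer over `Θ` of the divergence between `p` and the model probabilities. -/
def IsMDPDE {k L : ℕ} (P : Plan k L) (β : ℝ) (p : Fin (L + 1) → ℝ) (θ : Param) : Prop :=
  θ ∈ paramSpace ∧ IsMinOn (fun η => dpd β p (P.prob η)) paramSpace θ

/-- The mean lifetime `h₂(θ) = θ₀⁻¹ exp (-θ₁ x₀)` at stress level `x₀`. -/
noncomputable def meanLifetime (x₀ : ℝ) (θ : Param) : ℝ := 1 / θ 0 * Real.exp (-(θ 1 * x₀))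

/-- The explicit gradient of the mean lifetime. -/
noncomputable def gradMeanLifetime (x₀ : ℝ) (θ : Param) : Param :=
  !₂[-1 / θ 0 ^ 2 * Real.exp (-(θ 1 * x₀)), -x₀ / θ 0 * Real.exp (-(θ 1 * x₀))]

/-- The asymptotic variance `∇h₂ᵀ J⁻¹ K J⁻¹ ∇h₂` of the estimated mean lifetime. -/
noncomputable def meanLifetimeVariance {k L : ℕ} (P : Plan k L) (β x₀ : ℝ) (θ : Param) : ℝ :=
  dotProduct (gradMeanLifetime x₀ θ).ofLp
    (((P.J β θ)⁻¹ * P.K β θ * (P.J β θ)⁻¹).mulVec (gradMeanLifetime x₀ θ).ofLp)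

end StepStress

/-! The argument is the delta method for an implicitly defined estimator. Write `p` for the
empirical frequencies, `π` for the true cell probabilities and `S = Wᵀ D^{β-1}`.

At the inspection times the survival function is `exp (-H_j)`, with `H_j` the cumulative hazard, and
`z_j` is minus its gradient; hence the rows of `W` are the gradients of the cell probabilities
(`hasFDerivAt_prob`). Two distinct stress levels make `W` injective, so `J_β = S W` is positive
definite (`J_posDef`), and they make `θ` a continuous function of the cell probabilities
(`tendsto_of_tendsto_prob`).

The divergence separates probability vectors, so parameters at least as good as `θ₀` for `p` tend to
`θ₀` as `p → π`. This gives both existence of minimizers for `p` near `π` and their consistency. A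
minimizer solves `S(θ) (π(θ) - p) = 0`; linearizing at `θ₀` yields `θ - θ₀ = J⁻¹ S (p - π) + o(‖p -
π‖)`, uniformly over minimizers (`isMDPDE_expansion`). This part is deterministic.

Probability enters twice: the central limit theorem for the scalar `c ⬝ᵥ (p - π)` with `c = ∇h₂ᵀ J⁻¹
S`, a sum of i.i.d. bounded variables, and tightness of `√N ‖p - π‖`, which makes the remainder
negligible. Since `K_β = S (D_π - π πᵀ) Sᵀ`, the limiting variance is the stated one
(`meanLifetimeVariance_eq`). -/

namespace StepStress

/-! ### Cumulative hazard, cell probabilities and their gradients -/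

namespace Plan

variable {k L : ℕ} (P : Plan k L)

/-- The integral up to time `s`, lying in the `i`-th stage, of the step function that takes the
value `w m` in the `m`-th stage. -/
noncomputable def stageSum (w : ℕ → ℝ) (i : ℕ) (s : ℝ) : ℝ :=
  ∑ m ∈ Finset.Icc 1 (i - 1), (P.τ m - P.τ (m - 1)) * w m + w i * (s - P.τ (i - 1))

/-- The integral up to time `t j` of the step function that takes the value `w m` in the `m`-th
stage, as a sum over inspection intervals. -/
noncomputable def accum (w : ℕ → ℝ) (j : ℕ) : ℝ :=
  ∑ m ∈ Finset.range j, w (P.level (P.t m)) * (P.t (m + 1) - P.t m)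

lemma t_le_iff {i j : ℕ} (hi : i ≤ L) (hj : j ≤ L) : P.t i ≤ P.t j ↔ i ≤ j := by
  constructor
  · intro h
    by_contra! hlt
    exact absurd h (not_le.2 (P.t_lt j i hlt hi))
  · intro h
    rcases h.eq_or_lt with rfl | h
    · exact le_rfl
    · exact (P.t_lt i j h hj).le

lemma l_le_iff {i j : ℕ} (hi : i ≤ k) (hj : j ≤ k) : P.l i ≤ P.l j ↔ i ≤ j := by
  constructor
  · intro h
    by_contra! hlt
    exact absurd h (not_le.2 (P.l_lt j i hlt hi))
  · intro h
    rcases h.eq_or_lt with rfl | h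
    · exact le_rfl
    · exact (P.l_lt i j h hj).le

lemma l_le {i : ℕ} (hi : i ≤ k) : P.l i ≤ L := by
  have := (P.l_le_iff hi le_rfl).2 hi
  rwa [P.l_last] at this

/-- The change times counted by `level` are exactly the first `i`. The upper bound on `j` is needed
only for `i + 1 < k`, because the last stage is never left; this covers `t L`. -/
lemma level_t {i j : ℕ} (hi : i < k) (hj : j ≤ L) (h₁ : P.l i ≤ j)
    (h₂ : i + 1 < k → j < P.l (i + 1)) : P.level (P.t j) = i + 1 := by
  have : (Finset.Icc 1 (k - 1)).filter (fun m => P.τ m ≤ P.t j) = Finset.Icc 1 i := by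
    ext m
    rw [Finset.mem_filter, Finset.mem_Icc, Finset.mem_Icc, τ]
    constructor
    · rintro ⟨⟨h1, h3⟩, h4⟩
      refine ⟨h1, ?_⟩
      rw [P.t_le_iff (P.l_le (by omega)) hj] at h4
      by_contra! hlt
      have h5 := h₂ (by omega)
      have h6 := (P.l_le_iff (i := i + 1) (j := m) (by omega) (by omega)).2 hlt
      omega
    · rintro ⟨h1, h3⟩
      refine ⟨⟨h1, by omega⟩, ?_⟩
      rw [P.t_le_iff (P.l_le (by omega)) hj]
      exact ((P.l_le_iff (by omega) (by omega)).2 h3).trans h₁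
  rw [level, this, Nat.card_Icc]
  omega

lemma exists_stage {j : ℕ} (hj : j < L) : ∃ i < k, P.l i ≤ j ∧ j < P.l (i + 1) := by
  have hex : ∃ m, m ≤ k ∧ j < P.l m := ⟨k, le_rfl, by rwa [P.l_last]⟩
  classical
  obtain ⟨h1, h2⟩ := Nat.find_spec hex
  rcases hm : Nat.find hex with _ | i
  · rw [hm, P.l_zero] at h2
    omega
  · rw [hm] at h1 h2
    refine ⟨i, by omega, ?_, h2⟩
    have := Nat.find_min hex (m := i) (by omega)
    push Not at this
    exact this (by omega)

lemma accum_succ (w : ℕ → ℝ) (j : ℕ) :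
    P.accum w (j + 1) = P.accum w j + w (P.level (P.t j)) * (P.t (j + 1) - P.t j) :=
  Finset.sum_range_succ _ _

/-- Continuity at a change time: the formulas of the ending and of the beginning stage agree there.
-/
lemma stageSum_succ (w : ℕ → ℝ) (i : ℕ) :
    P.stageSum w (i + 2) (P.τ (i + 1)) = P.stageSum w (i + 1) (P.τ (i + 1)) := by
  simp only [stageSum, Nat.add_one_sub_one, show i + 2 - 1 = i + 1 by omega]
  rw [Finset.sum_Icc_succ_top (by omega)]
  simp
  ring

lemma stageSum_level (w : ℕ → ℝ) {j : ℕ} (hj : j ≤ L) :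
    P.stageSum w (P.level (P.t j)) (P.t j) = P.accum w j := by
  induction j with
  | zero =>
    have h2 := P.two_le
    have h : P.level (P.t 0) = 0 + 1 :=
      P.level_t (by omega) hj (by simp [P.l_zero]) fun h => by
        have := P.l_lt 0 1 (by omega) (by omega)
        simp only [zero_add]
        omega
    rw [h]
    simp [stageSum, accum, τ, P.l_zero]
  | succ j ih =>
    obtain ⟨i, hi, h1, h2⟩ := P.exists_stage (j := j) (by omega)
    have hlev : P.level (P.t j) = i + 1 := P.level_t hi (by omega) h1 fun _ => h2
    have key : P.stageSum w (P.level (P.t (j + 1))) (P.t (j + 1)) =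
        P.stageSum w (i + 1) (P.t (j + 1)) := by
      -- The level jumps at `t (j + 1)` only if this is a change time other than the last one; there
      -- continuity applies.
      by_cases hc : i + 1 < k ∧ j + 1 = P.l (i + 1)
      · have hlev' : P.level (P.t (j + 1)) = i + 1 + 1 :=
          P.level_t hc.1 hj hc.2.ge fun h => by
            have := P.l_lt (i + 1) (i + 1 + 1) (by omega) (by omega)
            omega
        have := P.stageSum_succ w i
        rw [hlev', hc.2]
        simpa [τ] using this
      · have hlev' : P.level (P.t (j + 1)) = i + 1 :=
          P.level_t hi hj (by omega) fun h => by
            have : j + 1 ≠ P.l (i + 1) := fun h' => hc ⟨h, h'⟩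
            omega
        rw [hlev']
    rw [key, P.accum_succ, ← ih (by omega), hlev]
    simp only [stageSum]
    ring

variable {θ : Param}

lemma lam_pos (hθ : θ ∈ paramSpace) (i : ℕ) : 0 < P.lam θ i :=
  mul_pos hθ (Real.exp_pos _)

lemma lam_mul_exposure (hθ : θ ∈ paramSpace) (s : ℝ) :
    P.lam θ (P.level s) * P.exposure θ s = P.stageSum (P.lam θ) (P.level s) s := by
  have := (P.lam_pos hθ (P.level s)).ne'
  rw [exposure, shift, stageSum]
  field_simp
  ring

/-- The `x_i` in the exposure term cancels the `-x_i` in `a*_{i-1}`, so each past stage is weighted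
by its own stress. The result is the derivative of the cumulative hazard in `θ₁`. -/
lemma lam_mul_exposure_add_shiftStar (hθ : θ ∈ paramSpace) (s : ℝ) :
    P.lam θ (P.level s) *
      (P.exposure θ s * P.x (P.level s) + P.shiftStar θ (P.level s)) =
    P.stageSum (fun i => P.lam θ i * P.x i) (P.level s) s := by
  have h := (P.lam_pos hθ (P.level s)).ne'
  rw [mul_add, ← mul_assoc, P.lam_mul_exposure hθ, shiftStar, ← mul_assoc, mul_one_div,
    div_self h, one_mul, stageSum, stageSum, add_mul, Finset.sum_mul, add_right_comm,
    ← Finset.sum_add_distrib]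
  congr 1
  · exact Finset.sum_congr rfl fun m _ => by ring
  · ring

/-- The cumulative hazard at the `j`-th inspection time. -/
noncomputable def hazard (θ : Param) (j : ℕ) : ℝ := P.accum (P.lam θ) j

/-- The derivative of the cumulative hazard at the `j`-th inspection time in the second
parameter. -/
noncomputable def hazardDeriv (θ : Param) (j : ℕ) : ℝ := P.accum (fun i => P.lam θ i * P.x i) j

/-- The survival probability at the `j`-th inspection time, with the convention that it vanishes
after the last inspection. -/
noncomputable def surv (θ : Param) (j : ℕ) : ℝ :=
  if j ≤ L then Real.exp (-P.hazard θ j) else 0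

lemma hazard_zero : P.hazard θ 0 = 0 := by simp [hazard, accum]

lemma t_pos_iff {j : ℕ} (hj : j ≤ L) : 0 < P.t j ↔ 0 < j := by
  have := P.t_le_iff hj (Nat.zero_le L)
  rw [P.t_zero] at this
  rw [← not_le, this]
  omega

lemma cdf_t (hθ : θ ∈ paramSpace) {j : ℕ} (hj : j ≤ L) :
    P.cdf θ (P.t j) = 1 - Real.exp (-P.hazard θ j) := by
  rw [cdf]
  split_ifs with h
  · have : j = 0 := by
      by_contra hne
      exact absurd h (not_le.2 ((P.t_pos_iff hj).2 (by omega)))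
    subst this
    simp [hazard_zero]
  · rw [P.lam_mul_exposure hθ, P.stageSum_level _ hj, hazard]

lemma prob_eq (hθ : θ ∈ paramSpace) (j : Fin (L + 1)) :
    P.prob θ j = P.surv θ j - P.surv θ (j + 1) := by
  have hj := j.2
  rw [prob]
  split_ifs with h
  · rw [P.cdf_t hθ (j := j + 1) (by omega), P.cdf_t hθ h.le, surv, surv, if_pos h.le, if_pos (by omega)]
    ring
  · rw [P.cdf_t hθ le_rfl, show (j : ℕ) = L by omega, surv, surv, if_pos le_rfl, if_neg (by omega)]
    ring

/-- The rate in the density turns both entries into stage sums. The conventions at the ends fit: the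
hazard and its derivative vanish at `j = 0`, and `surv` vanishes beyond `L`. -/
lemma z_eq (hθ : θ ∈ paramSpace) (j : ℕ) :
    P.z θ j = P.surv θ j • ![P.hazard θ j / θ 0, P.hazardDeriv θ j] := by
  by_cases hj : j ≤ L
  · rcases Nat.eq_zero_or_pos j with rfl | hpos
    · ext i
      fin_cases i <;> simp [z, hazard, hazardDeriv, accum]
    · have ht := (P.t_pos_iff hj).2 hpos
      rw [z, if_pos ⟨hpos, hj⟩, pdf, if_neg (not_le.2 ht), P.lam_mul_exposure hθ,
        P.stageSum_level _ hj, surv, if_pos hj, hazard, hazardDeriv, ← P.stageSum_level _ hj,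
        ← P.stageSum_level _ hj, ← P.lam_mul_exposure hθ, ← P.lam_mul_exposure_add_shiftStar hθ]
      ext i
      fin_cases i <;> simp <;> ring
  · rw [z, if_neg (by omega), surv, if_neg hj, zero_smul]

lemma surv_zero : P.surv θ 0 = 1 := by simp [surv, hazard_zero]

lemma surv_last : P.surv θ (L + 1) = 0 := by simp [surv]

lemma sum_prob (hθ : θ ∈ paramSpace) : ∑ j, P.prob θ j = 1 := by
  simp_rw [P.prob_eq hθ]
  rw [Fin.sum_univ_eq_sum_range (fun j => P.surv θ j - P.surv θ (j + 1)),
    Finset.sum_range_sub', surv_zero, surv_last, sub_zero]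

lemma sum_W (i : Fin 2) : ∑ j, P.W θ j i = 0 := by
  simp only [W, Matrix.of_apply, Pi.sub_apply]
  rw [Fin.sum_univ_eq_sum_range (fun j => P.z θ (j + 1) i - P.z θ j i),
    Finset.sum_range_sub (fun j => P.z θ j i)]
  simp [z]

lemma hazard_succ (j : ℕ) : P.hazard θ (j + 1) =
    P.hazard θ j + P.lam θ (P.level (P.t j)) * (P.t (j + 1) - P.t j) :=
  P.accum_succ _ _

lemma prob_pos (hθ : θ ∈ paramSpace) (j : Fin (L + 1)) : 0 < P.prob θ j := by
  have hj := j.2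
  rw [P.prob_eq hθ, surv, surv, if_pos (by omega)]
  split_ifs with h
  · rw [sub_pos, Real.exp_lt_exp, neg_lt_neg_iff, hazard_succ]
    have := mul_pos (P.lam_pos hθ (P.level (P.t j)))
      (sub_pos.2 (P.t_lt j (j + 1) (by omega) h))
    linarith
  · simpa using Real.exp_pos _

lemma prob_le_one (hθ : θ ∈ paramSpace) (j : Fin (L + 1)) : P.prob θ j ≤ 1 := by
  rw [← P.sum_prob hθ]
  exact Finset.single_le_sum (fun i _ => (P.prob_pos hθ i).le) (Finset.mem_univ j)

lemma one_lt_last : P.l 1 < L := by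
  have h := P.two_le
  have := P.l_lt 1 2 (by omega) h
  have := P.l_le h
  omega

lemma level_first : P.level (P.t 0) = 1 := by
  have h := P.two_le
  refine P.level_t (i := 0) (by omega) (by omega) (by simp [P.l_zero]) fun _ => ?_
  have := P.l_lt 0 1 (by omega) (by omega)
  simp only [zero_add]
  omega

lemma level_second : P.level (P.t (P.l 1)) = 2 := by
  have h := P.two_le
  exact P.level_t (i := 1) (by omega) P.one_lt_last.le le_rfl fun _ =>
    P.l_lt 1 2 (by omega) h

/-- The linear form on the parameter space with the given coefficients. -/
noncomputable def _root_.StepStress.linForm (v : Fin 2 → ℝ) : Param →L[ℝ] ℝ :=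
  v 0 • EuclideanSpace.proj 0 + v 1 • EuclideanSpace.proj 1

lemma _root_.StepStress.linForm_apply (v : Fin 2 → ℝ) (u : Param) :
    linForm v u = v 0 * u 0 + v 1 * u 1 := by
  simp [linForm]

lemma hasFDerivAt_lam (hθ : θ ∈ paramSpace) (i : ℕ) :
    HasFDerivAt (fun η => P.lam η i) (linForm ![P.lam θ i / θ 0, P.lam θ i * P.x i]) θ := by
  have h0 : HasFDerivAt (fun η : Param => η 0) (EuclideanSpace.proj 0 : Param →L[ℝ] ℝ) θ :=
    (EuclideanSpace.proj 0 : Param →L[ℝ] ℝ).hasFDerivAt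
  have h1 : HasFDerivAt (fun η : Param => η 1) (EuclideanSpace.proj 1 : Param →L[ℝ] ℝ) θ :=
    (EuclideanSpace.proj 1 : Param →L[ℝ] ℝ).hasFDerivAt
  refine (h0.mul (h1.mul_const (P.x i)).exp).congr_fderiv ?_
  have : θ 0 ≠ 0 := (show 0 < θ 0 from hθ).ne'
  ext u
  simp [linForm_apply, lam, rate]
  field_simp
  ring

lemma hasFDerivAt_hazard (hθ : θ ∈ paramSpace) (j : ℕ) :
    HasFDerivAt (fun η => P.hazard η j) (linForm ![P.hazard θ j / θ 0, P.hazardDeriv θ j]) θ := by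
  refine (HasFDerivAt.fun_sum fun m (_ : m ∈ Finset.range j) =>
    (P.hasFDerivAt_lam hθ (P.level (P.t m))).mul_const (P.t (m + 1) - P.t m)).congr_fderiv ?_
  ext u
  simp [linForm_apply, hazard, hazardDeriv, accum, Finset.sum_div, Finset.sum_mul,
    ← Finset.sum_add_distrib]
  exact Finset.sum_congr rfl fun m _ => by ring

lemma hasFDerivAt_surv (hθ : θ ∈ paramSpace) (j : ℕ) :
    HasFDerivAt (fun η => P.surv η j) (-linForm (P.z θ j)) θ := by
  rw [P.z_eq hθ]
  by_cases hj : j ≤ L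
  · simp only [surv, if_pos hj]
    refine (P.hasFDerivAt_hazard hθ j).neg.exp.congr_fderiv ?_
    ext u
    simp [linForm_apply]
    ring
  · simp only [surv, if_neg hj]
    refine (hasFDerivAt_const (0 : ℝ) θ).congr_fderiv ?_
    ext u
    simp [linForm_apply]

lemma _root_.StepStress.isOpen_paramSpace : IsOpen paramSpace :=
  isOpen_lt continuous_const (EuclideanSpace.proj 0 : Param →L[ℝ] ℝ).continuous

/-- A cell probability is a difference of survival probabilities, whose gradients are the `-z_j`. -/
lemma hasFDerivAt_prob (hθ : θ ∈ paramSpace) (j : Fin (L + 1)) :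
    HasFDerivAt (fun η => P.prob η j) (linForm (P.W θ j)) θ := by
  have h := (P.hasFDerivAt_surv hθ j).sub (P.hasFDerivAt_surv hθ (j + 1))
  refine (h.congr_of_eventuallyEq ?_).congr_fderiv ?_
  · filter_upwards [isOpen_paramSpace.mem_nhds hθ] with η hη using P.prob_eq hη j
  · ext u
    simp [linForm_apply, W]
    ring

lemma continuousAt_prob (hθ : θ ∈ paramSpace) (j : Fin (L + 1)) :
    ContinuousAt (fun η => P.prob η j) θ :=
  (P.hasFDerivAt_prob hθ j).continuousAt

lemma continuousAt_z (hθ : θ ∈ paramSpace) (j : ℕ) (i : Fin 2) :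
    ContinuousAt (fun η => P.z η j i) θ := by
  have h0 : θ 0 ≠ 0 := (show 0 < θ 0 from hθ).ne'
  have hcoord : ∀ i : Fin 2, ContinuousAt (fun η : Param => η i) θ := fun i =>
    (EuclideanSpace.proj i : Param →L[ℝ] ℝ).continuous.continuousAt
  have hd : ContinuousAt (fun η => P.hazardDeriv η j) θ := by
    unfold hazardDeriv accum
    exact tendsto_finsetSum _ fun m _ =>
      ((P.hasFDerivAt_lam hθ _).continuousAt.mul continuousAt_const).mul continuousAt_const
  have key : ContinuousAt
      (fun η => (P.surv η j • ![P.hazard η j / η 0, P.hazardDeriv η j]) i) θ := by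
    have hs := (P.hasFDerivAt_surv hθ j).continuousAt
    have hh := (P.hasFDerivAt_hazard hθ j).continuousAt
    fin_cases i
    · simpa using! hs.mul (hh.div (hcoord 0) h0)
    · simpa using! hs.mul hd
  refine key.congr ?_
  filter_upwards [isOpen_paramSpace.mem_nhds hθ] with η hη
  rw [P.z_eq hη]

lemma continuousAt_W (hθ : θ ∈ paramSpace) (j : Fin (L + 1)) (i : Fin 2) :
    ContinuousAt (fun η => P.W η j i) θ :=
  (P.continuousAt_z hθ (j + 1) i).sub (P.continuousAt_z hθ j i)

/-- A kernel vector is orthogonal to every `z_j`, hence to the gradient of every hazard increment.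
Increments at two distinct stress levels have independent gradients. -/
lemma W_mulVec_injective (hθ : θ ∈ paramSpace) : Function.Injective (P.W θ).mulVec := by
  refine (injective_iff_map_eq_zero (Matrix.mulVecLin (P.W θ))).2 fun v hv => ?_
  have hθ0 : θ 0 ≠ 0 := (show 0 < θ 0 from hθ).ne'
  have hz : ∀ j ≤ L, P.z θ j ⬝ᵥ v = 0 := by
    intro j hj
    induction j with
    | zero => simp [z]
    | succ j ih =>
      have h1 := congrFun hv ⟨j, by omega⟩
      simp only [Matrix.mulVecLin_apply, Matrix.mulVec, W, Pi.zero_apply] at h1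
      change (P.z θ (j + 1) - P.z θ j) ⬝ᵥ v = 0 at h1
      rw [sub_dotProduct, ih (by omega), sub_zero] at h1
      exact h1
  have hH : ∀ j ≤ L, P.hazard θ j / θ 0 * v 0 + P.hazardDeriv θ j * v 1 = 0 := by
    intro j hj
    have h1 := hz j hj
    rw [P.z_eq hθ, smul_dotProduct, surv, if_pos hj, smul_eq_mul] at h1
    simpa [dotProduct, Fin.sum_univ_two] using (mul_eq_zero.1 h1).resolve_left (Real.exp_ne_zero _)
  -- Subtract consecutive relations `hH` and divide by the positive hazard increment.
  have hx : ∀ j < L, v 0 / θ 0 + P.x (P.level (P.t j)) * v 1 = 0 := by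
    intro j hj
    have h1 := hH (j + 1) hj
    have h2 := hH j hj.le
    rw [hazard_succ, hazardDeriv, accum_succ, ← hazardDeriv] at h1
    have h3 := (mul_pos (P.lam_pos hθ (P.level (P.t j)))
      (sub_pos.2 (P.t_lt j (j + 1) (by omega) hj))).ne'
    refine (mul_eq_zero.1 (?_ : P.lam θ (P.level (P.t j)) * (P.t (j + 1) - P.t j) *
      (v 0 / θ 0 + P.x (P.level (P.t j)) * v 1) = 0)).resolve_left h3
    rw [← sub_eq_zero.2 (h1.trans h2.symm)]
    ring
  have h1 := hx 0 (by have := P.one_lt_last; omega)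
  have h2 := hx (P.l 1) P.one_lt_last
  rw [level_first] at h1
  rw [level_second] at h2
  have h12 := P.x_lt 1 2 le_rfl (by omega) P.two_le
  have hv1 : v 1 = 0 := by
    refine (mul_eq_zero.1 (?_ : (P.x 2 - P.x 1) * v 1 = 0)).resolve_left (by linarith)
    linarith
  have hv0 : v 0 = 0 := by
    rw [hv1, mul_zero, add_zero, div_eq_zero_iff] at h1
    exact h1.resolve_right hθ0
  ext i
  fin_cases i <;> simp [hv0, hv1]

lemma J_posDef (hθ : θ ∈ paramSpace) (β : ℝ) : (P.J β θ).PosDef := by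
  have hD : (Matrix.diagonal (fun j => P.prob θ j ^ (β - 1))).PosDef :=
    Matrix.PosDef.diagonal fun j => Real.rpow_pos_of_pos (P.prob_pos hθ j) _
  have := hD.conjTranspose_mul_mul_same (P.W_mulVec_injective hθ)
  rwa [Matrix.conjTranspose_eq_transpose_of_trivial] at this

open Filter Topology in
/-- The parameter depends continuously on the cell probabilities. -/
lemma tendsto_of_tendsto_prob {α : Type*} {ℓ : Filter α} {f : α → Param} {θ₀ : Param}
    (hθ₀ : θ₀ ∈ paramSpace) (hf : ∀ᶠ a in ℓ, f a ∈ paramSpace)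
    (h : ∀ j, Tendsto (fun a => P.prob (f a) j) ℓ (𝓝 (P.prob θ₀ j))) :
    Tendsto f ℓ (𝓝 θ₀) := by
  -- Invert the model one layer at a time: cell probabilities, survival, hazards, log rates. The log
  -- rate is affine in the stress, so its values at `x 1` and `x 2` determine slope and intercept.
  have hsurv : ∀ j ≤ L, Tendsto (fun a => P.surv (f a) j) ℓ (𝓝 (P.surv θ₀ j)) := by
    intro j hj
    induction j with
    | zero => simpa [surv_zero] using tendsto_const_nhds
    | succ j ih =>
      have h1 := (ih (by omega)).sub (h ⟨j, by omega⟩)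
      rw [P.prob_eq hθ₀, sub_sub_cancel] at h1
      refine h1.congr' ?_
      filter_upwards [hf] with a ha
      rw [P.prob_eq ha, sub_sub_cancel]
  have hhaz : ∀ j ≤ L, Tendsto (fun a => P.hazard (f a) j) ℓ (𝓝 (P.hazard θ₀ j)) := by
    intro j hj
    have h1 := ((hsurv j hj).log (by simp [surv, hj])).neg
    simpa [surv, hj] using h1
  have hlam : ∀ j < L, Tendsto (fun a => Real.log (P.lam (f a) (P.level (P.t j)))) ℓ
      (𝓝 (Real.log (P.lam θ₀ (P.level (P.t j))))) := by
    intro j hj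
    refine Tendsto.log ?_ (P.lam_pos hθ₀ _).ne'
    have hne := (sub_pos.2 (P.t_lt j (j + 1) (by omega) hj)).ne'
    have h1 := ((hhaz (j + 1) hj).sub (hhaz j hj.le)).div_const (P.t (j + 1) - P.t j)
    simpa [hazard_succ, mul_div_cancel_right₀ _ hne] using h1
  have hlog : ∀ {η : Param}, η ∈ paramSpace → ∀ i,
      Real.log (P.lam η i) = Real.log (η 0) + η 1 * P.x i := by
    intro η hη i
    rw [lam, rate, Real.log_mul (show 0 < η 0 from hη).ne' (Real.exp_ne_zero _), Real.log_exp]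
  have h1 := hlam 0 (by have := P.one_lt_last; omega)
  have h2 := hlam (P.l 1) P.one_lt_last
  rw [level_first] at h1
  rw [level_second] at h2
  have h12 : P.x 2 - P.x 1 ≠ 0 :=
    (sub_pos.2 (P.x_lt 1 2 le_rfl (by omega) P.two_le)).ne'
  have hslope : Tendsto (fun a => f a 1) ℓ (𝓝 (θ₀ 1)) := by
    have h3 := (h2.sub h1).div_const (P.x 2 - P.x 1)
    have e : ∀ {η : Param}, η ∈ paramSpace →
        (Real.log (P.lam η 2) - Real.log (P.lam η 1)) / (P.x 2 - P.x 1) = η 1 := by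
      intro η hη
      rw [hlog hη, hlog hη]
      field_simp
      ring
    rw [e hθ₀] at h3
    exact h3.congr' (hf.mono fun a ha => e ha)
  have hscale : Tendsto (fun a => f a 0) ℓ (𝓝 (θ₀ 0)) := by
    have h3 := (Real.continuous_exp.tendsto _).comp (h1.sub (hslope.mul_const (P.x 1)))
    have e : ∀ {η : Param}, η ∈ paramSpace →
        Real.exp (Real.log (P.lam η 1) - η 1 * P.x 1) = η 0 := by
      intro η hη
      rw [hlog hη, add_sub_cancel_right, Real.exp_log hη]
    rw [e hθ₀] at h3
    exact h3.congr' (hf.mono fun a ha => e ha)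
  have hcoord : Tendsto (fun a => (f a).ofLp) ℓ (𝓝 θ₀.ofLp) := by
    rw [tendsto_pi_nhds]
    intro i
    fin_cases i
    exacts [hscale, hslope]
  exact ((PiLp.continuous_toLp 2 (fun _ : Fin 2 => ℝ)).tendsto _).comp hcoord

end Plan

end StepStress

/-! ### Separation by the divergence, estimating equations, existence and consistency -/

namespace StepStress

open Filter Topology

lemma rpow_mul_rpow_sub_one {q : ℝ} (hq : 0 < q) (a : ℝ) : q * q ^ (a - 1) = q ^ a := by
  rw [Real.rpow_sub_one hq.ne', mul_div_cancel₀ _ hq.ne']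

/-- The summand of the density power divergence is nonnegative and vanishes on the diagonal
only. -/
lemma dpd_summand_pos {β p q : ℝ} (hβ : 0 < β) (hp : 0 < p) (hq : 0 ≤ q) (hpq : p ≠ q) :
    0 < q ^ (1 + β) - (1 + 1 / β) * p * q ^ β + 1 / β * p ^ (β + 1) := by
  rcases hq.eq_or_lt with rfl | hq
  · rw [Real.zero_rpow (by positivity), Real.zero_rpow hβ.ne']
    have : 0 < 1 / β * p ^ (β + 1) := by positivity
    simpa using this
  · have hpq' : 0 < p / q := div_pos hp hq
    -- Strict Bernoulli inequality for `(p / q) ^ (β + 1)`, that is, strict convexity of the power;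
    -- multiplying by `q ^ (β + 1) / β` gives the claim.
    have h := one_add_mul_self_lt_rpow_one_add (s := p / q - 1) (p := β + 1) (by linarith)
      (by rw [sub_ne_zero, Ne, div_eq_one_iff_eq hq.ne']; exact hpq) (by linarith)
    rw [add_sub_cancel, Real.div_rpow hp.le hq.le, lt_div_iff₀ (by positivity)] at h
    have e : q ^ (β + 1) = q * q ^ β := by rw [Real.rpow_add_one hq.ne', mul_comm]
    rw [add_comm 1 β, e]
    rw [e] at h
    have h2 : (1 + (β + 1) * (p / q - 1)) * (q * q ^ β) =
        (β + 1) * p * q ^ β - β * (q * q ^ β) := by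
      field_simp
      ring
    rw [h2] at h
    have h3 : q * q ^ β - (1 + 1 / β) * p * q ^ β + 1 / β * p ^ (β + 1) =
        (p ^ (β + 1) - ((β + 1) * p * q ^ β - β * (q * q ^ β))) / β := by
      field_simp
      ring
    rw [h3]
    exact div_pos (by linarith) hβ

lemma dpd_summand_self {β p : ℝ} (hp : 0 < p) :
    p ^ (1 + β) - (1 + 1 / β) * p * p ^ β + 1 / β * p ^ (β + 1) = 0 := by
  rw [add_comm 1 β, Real.rpow_add_one hp.ne']
  ring

lemma dpd_summand_nonneg {β p q : ℝ} (hβ : 0 < β) (hp : 0 < p) (hq : 0 ≤ q) :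
    0 ≤ q ^ (1 + β) - (1 + 1 / β) * p * q ^ β + 1 / β * p ^ (β + 1) := by
  rcases eq_or_ne p q with rfl | h
  · exact (dpd_summand_self hp).ge
  · exact (dpd_summand_pos hβ hp hq h).le

/-- A summand of the Kullback-Leibler divergence dominates a summand of the Hellinger distance. -/
lemma sq_sqrt_sub_sqrt_le {p q : ℝ} (hp : 0 < p) (hq : 0 < q) :
    (√p - √q) ^ 2 ≤ p * Real.log (p / q) - p + q := by
  have hsp := Real.sqrt_pos.2 hp
  have hsq := Real.sqrt_pos.2 hq
  -- Applying `log u ≤ u - 1` to the square root of `q / p`, rather than to `q / p`, produces the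
  -- Hellinger term.
  have h := Real.log_le_sub_one_of_pos (div_pos hsq hsp)
  have e : Real.log (p / q) = -(2 * Real.log (√q / √p)) := by
    rw [Real.log_div hsq.ne' hsp.ne', Real.log_sqrt hq.le, Real.log_sqrt hp.le,
      Real.log_div hp.ne' hq.ne']
    ring
  have h2 : p * (√q / √p - 1) = √p * √q - p := by
    have hp2 := Real.mul_self_sqrt hp.le
    field_simp
    linear_combination -√q * hp2
  have h3 := mul_le_mul_of_nonneg_left h hp.le
  rw [h2] at h3
  rw [e, sub_sq, Real.sq_sqrt hp.le, Real.sq_sqrt hq.le]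
  linarith

lemma continuousAt_dpd_left {n : ℕ} {β : ℝ} (hβ : 0 ≤ β) {π : Fin n → ℝ} (hπ : ∀ j, 0 < π j) :
    ContinuousAt (fun p => dpd β p π) π := by
  have hc : ∀ j, ContinuousAt (fun p : Fin n → ℝ => p j) π := fun j =>
    (continuous_apply j).continuousAt
  unfold dpd
  split_ifs with h
  · exact tendsto_finsetSum _ fun j _ => (hc j).mul
      (((hc j).div_const (π j)).log (div_pos (hπ j) (hπ j)).ne')
  · have h' : 0 ≤ β + 1 := by linarith
    exact tendsto_finsetSum _ fun j _ =>
      (continuousAt_const.sub ((continuousAt_const.mul (hc j)).mul continuousAt_const)).add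
        (continuousAt_const.mul ((hc j).rpow_const (Or.inr h')))

lemma dpd_self {n : ℕ} {β : ℝ} {π : Fin n → ℝ} (hπ : ∀ j, 0 < π j) :
    dpd β π π = 0 := by
  unfold dpd
  split_ifs with h
  · exact Finset.sum_eq_zero fun j _ => by rw [div_self (hπ j).ne', Real.log_one, mul_zero]
  · exact Finset.sum_eq_zero fun j _ => dpd_summand_self (hπ j)

/-- Probability vectors that are no farther in divergence from an approximation `p` of `π` than `π`
itself approximate `π`. -/
lemma tendsto_of_dpd_le {α : Type*} {ℓ : Filter α} {n : ℕ} {β : ℝ} (hβ : 0 ≤ β)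
    {π : Fin n → ℝ} (hπ : ∀ j, 0 < π j) (hπ1 : ∑ j, π j = 1)
    {p q : α → Fin n → ℝ} (hp : Tendsto p ℓ (𝓝 π)) (hq : ∀ᶠ a in ℓ, ∀ j, 0 < q a j)
    (hq1 : ∀ᶠ a in ℓ, ∑ j, q a j = 1)
    (hle : ∀ᶠ a in ℓ, dpd β (p a) (q a) ≤ dpd β (p a) π) :
    Tendsto q ℓ (𝓝 π) := by
  have hpj : ∀ j, Tendsto (fun a => p a j) ℓ (𝓝 (π j)) := fun j => (tendsto_pi_nhds.1 hp) j
  have hp0 : ∀ᶠ a in ℓ, ∀ j, 0 < p a j :=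
    eventually_all.2 fun j => (hpj j).eventually_const_lt (hπ j)
  have hlim : Tendsto (fun a => dpd β (p a) π) ℓ (𝓝 0) := by
    rw [← dpd_self hπ (β := β)]
    exact (continuousAt_dpd_left hβ hπ).tendsto.comp hp
  rcases hβ.eq_or_lt with rfl | hβ
  -- For `β = 0` the divergence is not continuous where some `q j = 0`, so the Hellinger bound
  -- replaces compactness. The correction `- ∑ p + 1` is there because `p a` need not sum to one.
  · have hsum : Tendsto (fun a => dpd 0 (p a) π - ∑ j, p a j + 1) ℓ (𝓝 0) := by
      have := (hlim.sub (tendsto_finsetSum Finset.univ fun j _ => hpj j)).add_const 1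
      simpa [hπ1] using this
    have hsqrt : ∀ j, Tendsto (fun a => (√(p a j) - √(q a j)) ^ 2) ℓ (𝓝 0) := by
      intro j
      refine tendsto_of_tendsto_of_tendsto_of_le_of_le' tendsto_const_nhds hsum
        (Eventually.of_forall fun a => sq_nonneg _) ?_
      filter_upwards [hp0, hq, hq1, hle] with a hpa hqa hqa1 hlea
      calc (√(p a j) - √(q a j)) ^ 2
          ≤ ∑ i, (√(p a i) - √(q a i)) ^ 2 :=
            Finset.single_le_sum (f := fun i => (√(p a i) - √(q a i)) ^ 2)
              (fun i _ => sq_nonneg _) (Finset.mem_univ j)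
        _ ≤ ∑ i, (p a i * Real.log (p a i / q a i) - p a i + q a i) :=
            Finset.sum_le_sum fun i _ => sq_sqrt_sub_sqrt_le (hpa i) (hqa i)
        _ = dpd 0 (p a) (q a) - ∑ i, p a i + 1 := by
            rw [Finset.sum_add_distrib, Finset.sum_sub_distrib, hqa1, dpd, if_pos rfl]
        _ ≤ _ := by linarith
    rw [tendsto_pi_nhds]
    intro j
    have h1 : Tendsto (fun a => √(p a j) - √(q a j)) ℓ (𝓝 0) := by
      rw [tendsto_zero_iff_abs_tendsto_zero]
      have := (hsqrt j).sqrt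
      simpa [Function.comp_def, Real.sqrt_sq_eq_abs] using this
    have h2 := ((hpj j).sqrt.sub h1).pow 2
    rw [sub_zero, Real.sq_sqrt (hπ j).le] at h2
    refine h2.congr' ?_
    filter_upwards [hq] with a ha
    rw [sub_sub_cancel, Real.sq_sqrt (ha j).le]
  -- For `β > 0` the divergence is continuous on the whole cube: along each ultrafilter `q` has a
  -- limit `y` with `dpd β π y ≤ 0`, which forces `y = π`.
  · rw [tendsto_iff_ultrafilter]
    intro g hg
    have hmem : ∀ᶠ a in (g : Filter α), q a ∈ Set.Icc (0 : Fin n → ℝ) 1 := by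
      filter_upwards [hg hq, hg hq1] with a ha ha1
      refine ⟨fun j => (ha j).le, fun j => ?_⟩
      rw [Pi.one_apply, ← ha1]
      exact Finset.single_le_sum (fun i _ => (ha i).le) (Finset.mem_univ j)
    obtain ⟨y, hy, hgy⟩ := (isCompact_Icc (a := (0 : Fin n → ℝ)) (b := 1)).ultrafilter_le_nhds
      (g.map q) (le_principal_iff.2 hmem)
    have hqy : Tendsto q g (𝓝 y) := hgy
    have hqj : ∀ j, Tendsto (fun a => q a j) g (𝓝 (y j)) := fun j => (tendsto_pi_nhds.1 hqy) j
    have hgp : ∀ j, Tendsto (fun a => p a j) g (𝓝 (π j)) := fun j => (hpj j).mono_left hg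
    have hd : Tendsto (fun a => dpd β (p a) (q a)) g (𝓝 (dpd β π y)) := by
      unfold dpd
      rw [if_neg hβ.ne']
      simp only [if_neg hβ.ne']
      exact tendsto_finsetSum _ fun j _ =>
        (((hqj j).rpow_const (Or.inr (by linarith))).sub
          (((hgp j).const_mul _).mul ((hqj j).rpow_const (Or.inr hβ.le)))).add
          (((hgp j).rpow_const (Or.inr (by linarith))).const_mul _)
    have h0 : dpd β π y ≤ 0 := le_of_tendsto_of_tendsto hd (hlim.mono_left hg) (hg hle)
    rw [dpd, if_neg hβ.ne'] at h0
    have hnn := fun j (_ : j ∈ Finset.univ) => dpd_summand_nonneg hβ (hπ j) (hy.1 j)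
    have hz := (Finset.sum_eq_zero_iff_of_nonneg hnn).1 (h0.antisymm (Finset.sum_nonneg hnn))
    have : y = π := by
      ext j
      by_contra hne
      exact (dpd_summand_pos hβ (hπ j) (hy.1 j) (Ne.symm hne)).ne' (hz j (Finset.mem_univ j))
    rwa [← this]

variable {k L : ℕ} (P : Plan k L) {β : ℝ} {θ₀ : Param}

namespace Plan

lemma tendsto_of_dpd_prob_le (hβ : 0 ≤ β) (hθ₀ : θ₀ ∈ paramSpace) {α : Type*} {ℓ : Filter α}
    {p : α → Fin (L + 1) → ℝ} {f : α → Param} (hp : Tendsto p ℓ (𝓝 (P.prob θ₀)))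
    (hf : ∀ᶠ a in ℓ, f a ∈ paramSpace)
    (hle : ∀ᶠ a in ℓ, dpd β (p a) (P.prob (f a)) ≤ dpd β (p a) (P.prob θ₀)) :
    Tendsto f ℓ (𝓝 θ₀) := by
  refine P.tendsto_of_tendsto_prob hθ₀ hf (tendsto_pi_nhds.1 ?_)
  exact tendsto_of_dpd_le hβ (P.prob_pos hθ₀) (P.sum_prob hθ₀) hp
    (hf.mono fun a ha => P.prob_pos ha) (hf.mono fun a ha => P.sum_prob ha) hle

lemma hasFDerivAt_dpd {θ : Param} (hθ : θ ∈ paramSpace) (p : Fin (L + 1) → ℝ) :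
    HasFDerivAt (fun η => dpd β p (P.prob η))
      (∑ j, ((1 + β) * (P.prob θ j ^ (β - 1) * (P.prob θ j - p j))) • linForm (P.W θ j)) θ := by
  rcases eq_or_ne β 0 with rfl | hβ
  · simp only [dpd, if_true]
    have hterm : ∀ j, HasFDerivAt (fun η => p j * Real.log (p j / P.prob η j))
        ((-(p j / P.prob θ j)) • linForm (P.W θ j)) θ := by
      intro j
      have hpos := P.prob_pos hθ j
      rcases eq_or_ne (p j) 0 with h0 | h0
      · simp only [h0, zero_mul, zero_div, neg_zero, zero_smul]
        exact hasFDerivAt_const _ _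
      · have hd : HasDerivAt (fun q => p j * Real.log (p j / q)) (-(p j / P.prob θ j))
            (P.prob θ j) := by
          have := (((hasDerivAt_inv hpos.ne').const_mul (p j)).log
            (mul_ne_zero h0 (inv_ne_zero hpos.ne'))).const_mul (p j)
          convert! this using 1
          field_simp
        exact HasDerivAt.comp_hasFDerivAt (f := fun η => P.prob η j) θ hd
          (P.hasFDerivAt_prob hθ j)
    refine (HasFDerivAt.fun_sum fun j (_ : j ∈ Finset.univ) => hterm j).congr_fderiv ?_
    -- The cell probabilities sum to one, so adding this zero brings the Kullback-Leibler gradient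
    -- into the common form at `β = 0`.
    have hW : ∑ j, linForm (P.W θ j) = 0 := by
      ext u
      simp only [sum_apply, linForm_apply, Finset.sum_add_distrib,
        ← Finset.sum_mul, sum_W]
      simp
    rw [← add_zero (∑ j, -(p j / P.prob θ j) • linForm (P.W θ j)), ← hW,
      ← Finset.sum_add_distrib]
    refine Finset.sum_congr rfl fun j _ => ?_
    nth_rewrite 2 [← one_smul ℝ (linForm (P.W θ j))]
    rw [← add_smul]
    congr 1
    have hpos := P.prob_pos hθ j
    rw [zero_sub, Real.rpow_neg_one]
    field_simp
    ring
  · simp only [dpd, if_neg hβ]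
    refine HasFDerivAt.fun_sum fun j _ => ?_
    have hpos := P.prob_pos hθ j
    have hd : HasDerivAt (fun q => q ^ (1 + β) - (1 + 1 / β) * p j * q ^ β
        + 1 / β * p j ^ (β + 1))
        ((1 + β) * (P.prob θ j ^ (β - 1) * (P.prob θ j - p j))) (P.prob θ j) := by
      have := ((Real.hasDerivAt_rpow_const (p := 1 + β) (Or.inl hpos.ne')).sub
        ((Real.hasDerivAt_rpow_const (p := β) (Or.inl hpos.ne')).const_mul
          ((1 + 1 / β) * p j))).add_const (1 / β * p j ^ (β + 1))
      convert! this using 1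
      rw [add_sub_cancel_left, ← rpow_mul_rpow_sub_one hpos β]
      field_simp
      ring
    exact hd.comp_hasFDerivAt θ (P.hasFDerivAt_prob hθ j)

/-- The matrix `Wᵀ D^{β-1}` of the estimating equations. -/
noncomputable def score (β : ℝ) (θ : Param) : Matrix (Fin 2) (Fin (L + 1)) ℝ :=
  (P.W θ).transpose * Matrix.diagonal (fun j => P.prob θ j ^ (β - 1))

lemma score_apply (θ : Param) (i : Fin 2) (j : Fin (L + 1)) :
    P.score β θ i j = P.W θ j i * P.prob θ j ^ (β - 1) := by
  rw [score, Matrix.mul_diagonal, Matrix.transpose_apply]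

lemma score_mul_W (θ : Param) : P.score β θ * P.W θ = P.J β θ := rfl

lemma continuousAt_score {θ : Param} (hθ : θ ∈ paramSpace) (i : Fin 2) (j : Fin (L + 1)) :
    ContinuousAt (fun η => P.score β η i j) θ := by
  simp only [score_apply]
  exact (P.continuousAt_W hθ j i).mul
    ((P.continuousAt_prob hθ j).rpow_const (Or.inl (P.prob_pos hθ j).ne'))

end Plan

open Plan

/-- The estimating equations for the minimum density power divergence estimate. -/
lemma IsMDPDE.score_mulVec (hβ : 0 ≤ β) {p : Fin (L + 1) → ℝ} {θ : Param}
    (h : IsMDPDE P β p θ) : (P.score β θ).mulVec (P.prob θ - p) = 0 := by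
  have hz := (h.2.isLocalMin (isOpen_paramSpace.mem_nhds h.1)).hasFDerivAt_eq_zero
    (P.hasFDerivAt_dpd h.1 p)
  have hβ' : 1 + β ≠ 0 := by linarith
  have key : ∀ u : Param, ∑ j, P.prob θ j ^ (β - 1) * (P.prob θ j - p j) *
      (P.W θ j 0 * u 0 + P.W θ j 1 * u 1) = 0 := by
    intro u
    have h1 := congrArg (fun f : Param →L[ℝ] ℝ => f u) hz
    simp only [sum_apply, smul_apply, linForm_apply,
      smul_eq_mul, zero_apply, mul_assoc, ← Finset.mul_sum] at h1
    simpa only [mul_assoc] using (mul_eq_zero.1 h1).resolve_left hβ'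
  ext i
  simp only [Matrix.mulVec, dotProduct, score_apply, Pi.sub_apply, Pi.zero_apply]
  fin_cases i
  · have := key !₂[1, 0]
    simp only [Matrix.cons_val_zero, Matrix.cons_val_one, mul_one, mul_zero,
      add_zero] at this
    rw [← this]
    exact Finset.sum_congr rfl fun j _ => by simp; ring
  · have := key !₂[0, 1]
    simp only [Matrix.cons_val_zero, Matrix.cons_val_one, mul_one, mul_zero,
      zero_add] at this
    rw [← this]
    exact Finset.sum_congr rfl fun j _ => by simp; ring

/-- The estimates are consistent, uniformly in the choice of the minimizer. -/
lemma tendsto_isMDPDE (hβ : 0 ≤ β) (hθ₀ : θ₀ ∈ paramSpace) :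
    Tendsto (Prod.snd : (Fin (L + 1) → ℝ) × Param → Param)
      -- A filter on pairs `(p, θ)` restricting only `p → π` and minimality makes every limit
      -- uniform over the minimizers.
      (comap Prod.fst (𝓝 (P.prob θ₀)) ⊓ 𝓟 {a | IsMDPDE P β a.1 a.2}) (𝓝 θ₀) := by
  have h : ∀ᶠ a : (Fin (L + 1) → ℝ) × Param in
      comap Prod.fst (𝓝 (P.prob θ₀)) ⊓ 𝓟 {a | IsMDPDE P β a.1 a.2}, IsMDPDE P β a.1 a.2 :=
    mem_inf_of_right (mem_principal_self _)
  exact P.tendsto_of_dpd_prob_le hβ hθ₀ (tendsto_comap.mono_left inf_le_left)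
    (h.mono fun a ha => ha.1) (h.mono fun a ha => ha.2 hθ₀)

/-- Estimates exist for all probability vectors close to the true one. -/
lemma eventually_exists_isMDPDE (hβ : 0 ≤ β) (hθ₀ : θ₀ ∈ paramSpace) :
    ∀ᶠ p in 𝓝 (P.prob θ₀), ∃ θ, IsMDPDE P β p θ := by
  obtain ⟨r, hr, hball⟩ := Metric.nhds_basis_closedBall.mem_iff.1
    (isOpen_paramSpace.mem_nhds hθ₀)
  set A : Set ((Fin (L + 1) → ℝ) × Param) :=
    {a | a.2 ∈ paramSpace ∧ dpd β a.1 (P.prob a.2) ≤ dpd β a.1 (P.prob θ₀)} with hA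
  have hlim : Tendsto (Prod.snd : (Fin (L + 1) → ℝ) × Param → Param)
      (comap Prod.fst (𝓝 (P.prob θ₀)) ⊓ 𝓟 A) (𝓝 θ₀) := by
    have h : ∀ᶠ a in comap Prod.fst (𝓝 (P.prob θ₀)) ⊓ 𝓟 A, a ∈ A :=
      mem_inf_of_right (mem_principal_self _)
    exact P.tendsto_of_dpd_prob_le hβ hθ₀ (tendsto_comap.mono_left inf_le_left)
      (h.mono fun a ha => ha.1) (h.mono fun a ha => ha.2)
  -- For `p` near `π`, any parameter at least as good as `θ₀` lies in the compact ball, so a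
  -- minimizer over the ball is global.
  have hev := hlim.eventually (Metric.closedBall_mem_nhds θ₀ hr)
  rw [eventually_inf_principal, eventually_comap] at hev
  filter_upwards [hev] with p hp
  have hcont : ContinuousOn (fun η => dpd β p (P.prob η)) (Metric.closedBall θ₀ r) :=
    fun η hη => (P.hasFDerivAt_dpd (hball hη) p).continuousAt.continuousWithinAt
  obtain ⟨θ, hθ, hmin⟩ := (isCompact_closedBall θ₀ r).exists_isMinOn
    ⟨θ₀, Metric.mem_closedBall_self hr.le⟩ hcont
  refine ⟨θ, hball hθ, fun η hη => ?_⟩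
  rcases le_total (dpd β p (P.prob η)) (dpd β p (P.prob θ₀)) with h | h
  · exact hmin (hp (p, η) rfl ⟨hη, h⟩)
  · exact (hmin (Metric.mem_closedBall_self hr.le)).trans h

end StepStress

/-! ### First-order expansion of the estimator; the mean lifetime -/

namespace StepStress

open Filter Topology Asymptotics

lemma isBigO_mulVec {α ι κ : Type*} [Fintype ι] [Fintype κ] (A : Matrix ι κ ℝ)
    (f : α → κ → ℝ) (ℓ : Filter α) : (fun a => A.mulVec (f a)) =O[ℓ] f :=
  (LinearMap.toContinuousLinearMap (Matrix.mulVecLin A)).isBigO_comp f ℓ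

variable {k L : ℕ} (P : Plan k L) {β : ℝ} {θ₀ : Param}

open Plan

/-- First-order expansion of the estimates of a smooth function of the parameter. -/
lemma isMDPDE_expansion (hβ : 0 ≤ β) (hθ₀ : θ₀ ∈ paramSpace) {h : Param → ℝ} {g : Fin 2 → ℝ}
    (hh : HasFDerivAt h (linForm g) θ₀) :
    (fun a : (Fin (L + 1) → ℝ) × Param => h a.2 - h θ₀ -
      Matrix.vecMul g ((P.J β θ₀)⁻¹ * P.score β θ₀) ⬝ᵥ (a.1 - P.prob θ₀))
      =o[comap Prod.fst (𝓝 (P.prob θ₀)) ⊓ 𝓟 {a | IsMDPDE P β a.1 a.2}]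
      fun a => a.1 - P.prob θ₀ := by
  set ℓ := comap Prod.fst (𝓝 (P.prob θ₀)) ⊓
    𝓟 {a : (Fin (L + 1) → ℝ) × Param | IsMDPDE P β a.1 a.2} with hℓ
  have hlim : Tendsto Prod.snd ℓ (𝓝 θ₀) := tendsto_isMDPDE P hβ hθ₀
  have hmin : ∀ᶠ a in ℓ, IsMDPDE P β a.1 a.2 := mem_inf_of_right (mem_principal_self _)
  let U : (Fin (L + 1) → ℝ) × Param → Param := fun a => a.2 - θ₀
  let e : (Fin (L + 1) → ℝ) × Param → Fin (L + 1) → ℝ := fun a => a.1 - P.prob θ₀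
  let d : (Fin (L + 1) → ℝ) × Param → Fin (L + 1) → ℝ := fun a => P.prob a.2 - P.prob θ₀
  let G : (Fin (L + 1) → ℝ) × Param → ℝ := fun a => ‖U a‖ + ‖e a‖
  have hUG : U =O[ℓ] G := IsBigO.of_bound 1 (Eventually.of_forall fun a => by
    rw [one_mul, Real.norm_of_nonneg (by positivity)]
    exact le_add_of_nonneg_right (norm_nonneg _))
  have heG : e =O[ℓ] G := IsBigO.of_bound 1 (Eventually.of_forall fun a => by
    rw [one_mul, Real.norm_of_nonneg (by positivity)]
    exact le_add_of_nonneg_left (norm_nonneg _))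
  have h1 : (fun a => d a - (P.W θ₀).mulVec (U a).ofLp) =o[ℓ] U := by
    refine isLittleO_pi.2 fun j => ?_
    refine ((P.hasFDerivAt_prob hθ₀ j).isLittleO.comp_tendsto hlim).congr_left fun a => ?_
    simp [U, d, linForm_apply, Matrix.mulVec, dotProduct, Fin.sum_univ_two]
  have hdU : d =O[ℓ] U := by
    refine isBigO_pi.2 fun j => ?_
    exact (P.hasFDerivAt_prob hθ₀ j).isBigO_sub.comp_tendsto hlim
  have hdeG : (fun a => d a - e a) =O[ℓ] G := (hdU.trans hUG).sub heG
  -- The estimating equation says that the score matrix at the estimate kills `d - e`; moving it to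
  -- `θ₀` costs `o(1)` by continuity and consistency.
  have h2 : (fun a => (P.score β θ₀).mulVec (d a - e a)) =o[ℓ] fun a => d a - e a := by
    have h3 : (fun a => (P.score β θ₀ - P.score β a.2).mulVec (d a - e a)) =o[ℓ]
        fun a => d a - e a := by
      refine isLittleO_pi.2 fun i => ?_
      simp only [Matrix.mulVec, dotProduct]
      refine IsLittleO.fun_sum fun j _ => ?_
      have h4 : (fun a : (Fin (L + 1) → ℝ) × Param => (P.score β θ₀ - P.score β a.2) i j) =o[ℓ]
          fun _ => (1 : ℝ) := by
        rw [isLittleO_one_iff]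
        have := ((P.continuousAt_score (β := β) hθ₀ i j).tendsto.comp hlim).const_sub
          (P.score β θ₀ i j)
        simpa using this
      have h5 : (fun a => (d a - e a) j) =O[ℓ] fun a => ‖d a - e a‖ :=
        (isBigO_pi.1 (isBigO_refl (fun a => d a - e a) ℓ) j).norm_right
      have h6 := h4.mul_isBigO h5
      simp only [one_mul] at h6
      exact h6.of_norm_right
    refine h3.congr' ?_ EventuallyEq.rfl
    filter_upwards [hmin] with a ha
    have h7 := ha.score_mulVec P hβ
    rw [Matrix.sub_mulVec, show d a - e a = P.prob a.2 - a.1 by simp [d, e], h7, sub_zero]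
  have h3 : (fun a => (P.J β θ₀).mulVec (U a).ofLp - (P.score β θ₀).mulVec (e a)) =o[ℓ] G := by
    have h4 := (h2.trans_isBigO hdeG).sub
      (((isBigO_mulVec (P.score β θ₀) _ ℓ).trans_isLittleO h1).trans_isBigO hUG)
    refine h4.congr_left fun a => ?_
    have h5 : d a - e a - (d a - (P.W θ₀).mulVec (U a).ofLp) =
        (P.W θ₀).mulVec (U a).ofLp - e a := by abel
    rw [← Matrix.mulVec_sub, h5, Matrix.mulVec_sub, Matrix.mulVec_mulVec, score_mul_W]
  have hdet : IsUnit (P.J β θ₀).det :=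
    (Matrix.isUnit_iff_isUnit_det _).1 (P.J_posDef hθ₀ β).isUnit
  let B := (P.J β θ₀)⁻¹ * P.score β θ₀
  let V : (Fin (L + 1) → ℝ) × Param → Param := fun a => WithLp.toLp 2 (B.mulVec (e a))
  have hV : ∀ {f : (Fin (L + 1) → ℝ) × Param → Fin 2 → ℝ},
      (fun a => (WithLp.toLp 2 (f a) : Param)) =O[ℓ] f := fun {f} =>
    ((PiLp.continuousLinearEquiv 2 ℝ (fun _ : Fin 2 => ℝ)).symm :
      (Fin 2 → ℝ) →L[ℝ] Param).isBigO_comp f ℓ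
  have h4 : (fun a => U a - V a) =o[ℓ] G := by
    have h5 := hV.trans_isLittleO ((isBigO_mulVec (P.J β θ₀)⁻¹ _ ℓ).trans_isLittleO h3)
    refine h5.congr_left fun a => ?_
    rw [Matrix.mulVec_sub, Matrix.mulVec_mulVec, Matrix.mulVec_mulVec,
      Matrix.nonsing_inv_mul _ hdet, Matrix.one_mulVec, WithLp.toLp_sub]
  have hVe : V =O[ℓ] e := hV.trans (isBigO_mulVec B e ℓ)
  have hUe : U =O[ℓ] e := by
    obtain ⟨C, hC⟩ := hVe.bound
    -- From `‖U‖ ≤ (‖U‖ + ‖e‖) / 2 + C ‖e‖`, solved for `‖U‖`.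
    refine IsBigO.of_bound (2 * C + 1) ?_
    filter_upwards [hC, h4.bound (show (0 : ℝ) < 1 / 2 by norm_num)] with a ha1 ha2
    rw [Real.norm_of_nonneg (show 0 ≤ G a by positivity)] at ha2
    have h5 : ‖U a‖ ≤ ‖U a - V a‖ + ‖V a‖ := by
      simpa using norm_add_le (U a - V a) (V a)
    simp only [G] at ha2
    linarith
  have hGe : G =O[ℓ] e := hUe.norm_left.add (isBigO_refl e ℓ).norm_left
  have h5 : (fun a => linForm g (U a - V a)) =o[ℓ] e :=
    ((linForm g).isBigO_comp _ ℓ).trans_isLittleO (h4.trans_isBigO hGe)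
  have h6 : (fun a => h a.2 - h θ₀ - linForm g (U a)) =o[ℓ] e :=
    (hh.isLittleO.comp_tendsto hlim).trans_isBigO hUe
  refine (h6.add h5).congr_left fun a => ?_
  have h7 : linForm g (V a) = Matrix.vecMul g B ⬝ᵥ (a.1 - P.prob θ₀) := by
    rw [← Matrix.dotProduct_mulVec, linForm_apply]
    simp [V, e, dotProduct, Fin.sum_univ_two]
  rw [map_sub (linForm g) (U a) (V a), h7]
  ring

/-- First-order expansion of the estimates of a smooth function of the parameter, uniformly in the
choice of the minimizer. -/
lemma eventually_isMDPDE_expansion (hβ : 0 ≤ β) (hθ₀ : θ₀ ∈ paramSpace) {h : Param → ℝ}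
    {g : Fin 2 → ℝ} (hh : HasFDerivAt h (linForm g) θ₀) {ε : ℝ} (hε : 0 < ε) :
    ∀ᶠ p in 𝓝 (P.prob θ₀), ∀ θ, IsMDPDE P β p θ →
      |h θ - h θ₀ - Matrix.vecMul g ((P.J β θ₀)⁻¹ * P.score β θ₀) ⬝ᵥ (p - P.prob θ₀)| ≤
        ε * ‖p - P.prob θ₀‖ := by
  have h1 := (isMDPDE_expansion P hβ hθ₀ hh).bound hε
  rw [eventually_inf_principal, eventually_comap] at h1
  filter_upwards [h1] with p hp θ hθ
  exact hp (p, θ) rfl hθ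

lemma hasFDerivAt_meanLifetime (x₀ : ℝ) {θ : Param} (hθ : θ ∈ paramSpace) :
    HasFDerivAt (meanLifetime x₀) (linForm (gradMeanLifetime x₀ θ).ofLp) θ := by
  have h0 : HasFDerivAt (fun η : Param => η 0) (EuclideanSpace.proj 0 : Param →L[ℝ] ℝ) θ :=
    (EuclideanSpace.proj 0 : Param →L[ℝ] ℝ).hasFDerivAt
  have h1 : HasFDerivAt (fun η : Param => η 1) (EuclideanSpace.proj 1 : Param →L[ℝ] ℝ) θ :=
    (EuclideanSpace.proj 1 : Param →L[ℝ] ℝ).hasFDerivAt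
  have hne : θ 0 ≠ 0 := (show 0 < θ 0 from hθ).ne'
  have h2 : HasFDerivAt (fun η : Param => (η 0)⁻¹) _ θ :=
    HasDerivAt.comp_hasFDerivAt (f := fun η : Param => η 0) θ (hasDerivAt_inv hne) h0
  have h3 := h2.mul (h1.mul_const x₀).neg.exp
  have e : meanLifetime x₀ = fun η : Param => (η 0)⁻¹ * Real.exp (-(η 1 * x₀)) := by
    ext η
    rw [meanLifetime, one_div]
  rw [e]
  refine h3.congr_fderiv ?_
  ext u
  simp [linForm_apply, gradMeanLifetime]
  field_simp
  ring

lemma hasGradientAt_meanLifetime (x₀ : ℝ) {θ : Param} (hθ : θ ∈ paramSpace) :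
    HasGradientAt (meanLifetime x₀) (gradMeanLifetime x₀ θ) θ := by
  rw [hasGradientAt_iff_hasFDerivAt]
  refine (hasFDerivAt_meanLifetime x₀ hθ).congr_fderiv ?_
  ext u
  simp [linForm_apply, PiLp.inner_apply, Fin.sum_univ_two, mul_comm]

lemma integral_expMeasure {r : ℝ} (hr : 0 < r) :
    ∫ s, s ∂(ProbabilityTheory.expMeasure r) = 1 / r := by
  rw [ProbabilityTheory.expMeasure, ProbabilityTheory.gammaMeasure]
  have hm : Measurable (ProbabilityTheory.gammaPDF 1 r) :=
    (ProbabilityTheory.measurable_gammaPDFReal 1 r).ennreal_ofReal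
  rw [integral_withDensity_eq_integral_toReal_smul hm
    (Eventually.of_forall fun s => ENNReal.ofReal_lt_top)]
  -- The factor `s` is written `s ^ (2 - 1)` so that the integral is a Gamma integral with shape
  -- `2`.
  have e : (fun s => (ProbabilityTheory.gammaPDF 1 r s).toReal • s) =
      Set.indicator (Set.Ici 0) fun s => r * (s ^ ((2 : ℝ) - 1) * Real.exp (-(r * s))) := by
    ext s
    rw [ProbabilityTheory.gammaPDF_eq]
    by_cases hs : 0 ≤ s
    · rw [if_pos hs, Set.indicator_of_mem (Set.mem_Ici.2 hs)]
      rw [ENNReal.toReal_ofReal (by simp; positivity)]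
      norm_num
      ring
    · rw [if_neg hs, Set.indicator_of_notMem (by simpa using hs)]
      simp
  rw [e, MeasureTheory.integral_indicator measurableSet_Ici,
    MeasureTheory.integral_Ici_eq_integral_Ioi, MeasureTheory.integral_const_mul,
    Real.integral_rpow_mul_exp_neg_mul_Ioi (by norm_num) hr, Real.Gamma_two]
  norm_num
  field_simp

lemma integral_expMeasure_rate (x₀ : ℝ) {θ : Param} (hθ : θ ∈ paramSpace) :
    ∫ s, s ∂(ProbabilityTheory.expMeasure (rate θ x₀)) = meanLifetime x₀ θ := by
  rw [integral_expMeasure (r := rate θ x₀) (mul_pos hθ (Real.exp_pos _)), rate, meanLifetime, Real.exp_neg]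
  field_simp

end StepStress

/-! ### Central limit theorem and tightness for the empirical frequencies -/

namespace StepStress

open Filter Topology MeasureTheory ProbabilityTheory

variable {k L : ℕ} (P : Plan k L) {β : ℝ} {θ₀ : Param}

namespace Plan

lemma measurableSet_cell (j : Fin (L + 1)) : MeasurableSet (P.cell j) := by
  unfold cell
  split_ifs
  exacts [measurableSet_Ioc, measurableSet_Ioi]

lemma disjoint_cell {i j : Fin (L + 1)} (hij : i < j) : Disjoint (P.cell i) (P.cell j) := by
  rw [Set.disjoint_left]
  intro s hi hj
  have hj' := j.2
  have hlt : (i : ℕ) < j := hij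
  have h1 : (i : ℕ) < L := by omega
  rw [cell, if_pos h1] at hi
  have h2 : P.t (i + 1) ≤ P.t j := (P.t_le_iff (by omega) (by omega)).2 hlt
  have h3 : P.t j < s := by
    rw [cell] at hj
    split_ifs at hj with h
    · exact hj.1
    · rwa [show (j : ℕ) = L by omega]
  exact absurd hi.2 (not_le.2 (h2.trans_lt h3))

/-- The step function that takes the value `c j` on the `j`-th cell. -/
noncomputable def cellSum (c : Fin (L + 1) → ℝ) (s : ℝ) : ℝ :=
  ∑ j, c j * (P.cell j).indicator 1 s

lemma measurable_cellSum (c : Fin (L + 1) → ℝ) : Measurable (P.cellSum c) :=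
  Finset.measurable_fun_sum _ fun j _ =>
    (measurable_one.indicator (P.measurableSet_cell j)).const_mul _

/-- The cells are disjoint, so the mixed products vanish. This gives second moments from
`integral_cellSum`. -/
lemma cellSum_sq (c : Fin (L + 1) → ℝ) (s : ℝ) :
    P.cellSum c s ^ 2 = P.cellSum (fun j => c j ^ 2) s := by
  rw [cellSum, cellSum, sq, Finset.sum_mul_sum]
  refine Finset.sum_congr rfl fun i _ => ?_
  rw [Finset.sum_eq_single i]
  · by_cases h : s ∈ P.cell i <;> simp [h, sq]
  · intro j _ hji
    have hd : Disjoint (P.cell i) (P.cell j) := by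
      rcases lt_or_gt_of_ne hji with h | h
      exacts [(P.disjoint_cell h).symm, P.disjoint_cell h]
    by_cases h : s ∈ P.cell i
    · simp [Set.disjoint_left.1 hd h]
    · simp [h]
  · simp

lemma abs_cellSum_le (c : Fin (L + 1) → ℝ) (s : ℝ) : |P.cellSum c s| ≤ ∑ j, |c j| := by
  refine (Finset.abs_sum_le_sum_abs _ _).trans (Finset.sum_le_sum fun j _ => ?_)
  rw [abs_mul]
  refine mul_le_of_le_one_right (abs_nonneg _) ?_
  by_cases h : s ∈ P.cell j <;> simp [h]

lemma sum_cellSum {Ω : Type*} (T : ℕ → Ω → ℝ) (c : Fin (L + 1) → ℝ) (N : ℕ) (ω : Ω) :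
    ∑ i ∈ Finset.range N, P.cellSum c (T i ω) = N * (c ⬝ᵥ P.empirical T N ω) := by
  rcases Nat.eq_zero_or_pos N with rfl | hN
  · simp
  have hN' : (N : ℝ) ≠ 0 := by positivity
  simp only [cellSum, dotProduct, empirical]
  rw [Finset.sum_comm, Finset.mul_sum]
  refine Finset.sum_congr rfl fun j _ => ?_
  rw [← Finset.mul_sum, mul_div_assoc', mul_div_cancel₀ _ hN', Finset.card_filter]
  push_cast
  congr 1

end Plan

open Plan

section Probability

variable {Ω : Type*} [MeasurableSpace Ω] {μ : Measure Ω} [IsProbabilityMeasure μ] {T : ℕ → Ω → ℝ}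

lemma measureReal_cell {X : Ω → ℝ} (hX : Measurable X)
    (hlaw : ∀ s, μ.real {ω | X ω ≤ s} = P.cdf θ₀ s) (j : Fin (L + 1)) :
    μ.real (X ⁻¹' P.cell j) = P.prob θ₀ j := by
  have hm : ∀ s, MeasurableSet {ω | X ω ≤ s} := fun s => hX measurableSet_Iic
  have hj := j.2
  rw [cell, prob]
  split_ifs with h
  · have e : X ⁻¹' Set.Ioc (P.t j) (P.t (j + 1)) =
        {ω | X ω ≤ P.t (j + 1)} \ {ω | X ω ≤ P.t j} := by
      ext ω
      simp [and_comm]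
    have hle := P.t_lt j (j + 1) (by omega) h
    have hsub : ∀ {a b : ℝ}, a ≤ b → {ω | X ω ≤ a} ⊆ {ω | X ω ≤ b} :=
      fun hab ω (hω : X ω ≤ _) => show X ω ≤ _ from hω.trans hab
    rw [e, measureReal_sdiff (hsub hle.le) (hm _), hlaw, hlaw]
  · have e : X ⁻¹' Set.Ioi (P.t L) = {ω | X ω ≤ P.t L}ᶜ := by
      ext ω
      simp
    rw [e, probReal_compl_eq_one_sub (hm _), hlaw]

lemma integral_cellSum {X : Ω → ℝ} (hX : Measurable X)
    (hlaw : ∀ s, μ.real {ω | X ω ≤ s} = P.cdf θ₀ s) (c : Fin (L + 1) → ℝ) :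
    ∫ ω, P.cellSum c (X ω) ∂μ = c ⬝ᵥ P.prob θ₀ := by
  simp only [cellSum, dotProduct]
  have hm := fun j => hX (P.measurableSet_cell j)
  have e : ∀ j ω, (P.cell j).indicator (1 : ℝ → ℝ) (X ω) =
      (X ⁻¹' P.cell j).indicator (1 : Ω → ℝ) ω := fun j ω => rfl
  simp only [e]
  rw [integral_finsetSum]
  · refine Finset.sum_congr rfl fun j _ => ?_
    rw [integral_const_mul, integral_indicator_one (hm j), measureReal_cell P hX hlaw]
  · exact fun j _ => ((integrable_const (1 : ℝ)).indicator (hm j)).const_mul _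

lemma memLp_cellSum {X : Ω → ℝ} (hX : Measurable X) (c : Fin (L + 1) → ℝ) :
    MemLp (fun ω => P.cellSum c (X ω)) 2 μ :=
  MemLp.of_bound ((P.measurable_cellSum c).comp hX).aestronglyMeasurable (∑ j, |c j|)
    (Eventually.of_forall fun ω => P.abs_cellSum_le c (X ω))

lemma variance_cellSum {X : Ω → ℝ} (hX : Measurable X)
    (hlaw : ∀ s, μ.real {ω | X ω ≤ s} = P.cdf θ₀ s) (c : Fin (L + 1) → ℝ) :
    Var[fun ω => P.cellSum c (X ω); μ] =
      (fun j => c j ^ 2) ⬝ᵥ P.prob θ₀ - (c ⬝ᵥ P.prob θ₀) ^ 2 := by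
  rw [variance_eq_sub (memLp_cellSum P hX c), integral_cellSum P hX hlaw]
  simp only [Pi.pow_apply, cellSum_sq, integral_cellSum P hX hlaw]

lemma identDistrib_of_cdf (hT : ∀ i, Measurable (T i))
    (hlaw : ∀ i s, μ.real {ω | T i ω ≤ s} = P.cdf θ₀ s) (i : ℕ) :
    IdentDistrib (T i) (T 0) μ μ := by
  refine ⟨(hT i).aemeasurable, (hT 0).aemeasurable, ?_⟩
  have := Measure.isProbabilityMeasure_map (μ := μ) (hT i).aemeasurable
  refine Measure.ext_of_Iic _ _ fun s => ?_
  rw [Measure.map_apply (hT i) measurableSet_Iic, Measure.map_apply (hT 0) measurableSet_Iic,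
    ← measureReal_eq_measureReal_iff]
  exact (hlaw i s).trans (hlaw 0 s).symm

/-- The central limit theorem for linear combinations of the empirical frequencies. -/
lemma tendstoInDistribution_dotProduct_empirical
    (hT : ∀ i, Measurable (T i)) (hindep : iIndepFun T μ)
    (hlaw : ∀ i s, μ.real {ω | T i ω ≤ s} = P.cdf θ₀ s) (c : Fin (L + 1) → ℝ) :
    TendstoInDistribution
      (fun (N : ℕ) ω => √(N : ℝ) * (c ⬝ᵥ (P.empirical T N ω - P.prob θ₀))) atTop (id : ℝ → ℝ)
      (fun _ => μ)
      (gaussianReal 0 ((fun j => c j ^ 2) ⬝ᵥ P.prob θ₀ - (c ⬝ᵥ P.prob θ₀) ^ 2).toNNReal) := by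
  have hm := P.measurable_cellSum c
  have h := tendstoInDistribution_inv_sqrt_mul_sum_sub (P := μ)
    (X := fun i ω => P.cellSum c (T i ω)) (Y := (id : ℝ → ℝ))
    (P' := gaussianReal 0 Var[fun ω => P.cellSum c (T 0 ω); μ].toNNReal) HasLaw.id
    (memLp_cellSum P (hT 0) c) (hindep.comp (fun _ => P.cellSum c) fun _ => hm)
    (fun i => (identDistrib_of_cdf P hT hlaw i).comp hm)
  rw [variance_cellSum P (hT 0) (hlaw 0) c] at h
  convert! h using 3 with N ω
  rw [sum_cellSum, integral_cellSum P (hT 0) (hlaw 0), dotProduct_sub, ← mul_sub,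
    ← mul_assoc]
  congr 1
  rw [inv_mul_eq_div, Real.div_sqrt]

/-- Chebyshev's inequality: a cell indicator has variance at most `1`, so the bound does not depend
on `N`. -/
lemma measure_empirical_coord_le (hθ₀ : θ₀ ∈ paramSpace)
    (hT : ∀ i, Measurable (T i)) (hindep : iIndepFun T μ)
    (hlaw : ∀ i s, μ.real {ω | T i ω ≤ s} = P.cdf θ₀ s) {r : ℝ} (hr : 0 < r) (N : ℕ)
    (j : Fin (L + 1)) :
    μ {ω | r ≤ √(N : ℝ) * |P.empirical T N ω j - P.prob θ₀ j|} ≤ ENNReal.ofReal (1 / r ^ 2) := by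
  rcases Nat.eq_zero_or_pos N with rfl | hN
  · simp [not_le.2 hr]
  have hN' : (0 : ℝ) < N := by positivity
  set c : Fin (L + 1) → ℝ := Pi.single j 1 with hc
  let X : ℕ → Ω → ℝ := fun i ω => P.cellSum c (T i ω)
  have hL : ∀ i, MemLp (X i) 2 μ := fun i => memLp_cellSum P (hT i) c
  have hind : iIndepFun X μ := hindep.comp (fun _ => P.cellSum c) fun _ => P.measurable_cellSum c
  have hcp : c ⬝ᵥ P.prob θ₀ = P.prob θ₀ j := by simp [hc]
  have hvar : ∀ i, Var[X i; μ] ≤ 1 := by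
    intro i
    have h := variance_cellSum P (hT i) (hlaw i) c
    have h2 : (fun i => c i ^ 2) ⬝ᵥ P.prob θ₀ = P.prob θ₀ j := by
      have : (fun i => c i ^ 2) = c := by
        ext i
        by_cases hi : i = j <;> simp [hc, hi]
      rw [this, hcp]
    rw [hcp, h2] at h
    change Var[fun ω => P.cellSum c (T i ω); μ] ≤ 1
    rw [h]
    have := P.prob_le_one hθ₀ j
    nlinarith [sq_nonneg (P.prob θ₀ j)]
  have hsumvar : Var[∑ i ∈ Finset.range N, X i; μ] ≤ N := by
    rw [IndepFun.variance_sum (fun i _ => hL i) fun i _ i' _ h => hind.indepFun h]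
    exact (Finset.sum_le_sum fun i _ => hvar i).trans (by simp)
  have hmean : μ[∑ i ∈ Finset.range N, X i] = N * P.prob θ₀ j := by
    simp only [Finset.sum_apply]
    rw [integral_finsetSum _ fun i _ => (hL i).integrable one_le_two]
    simp only [X, integral_cellSum P (hT _) (hlaw _), hcp]
    simp
  have hS : MemLp (∑ i ∈ Finset.range N, X i) 2 μ := memLp_finsetSum' _ fun i _ => hL i
  have hpos : 0 < r * √(N : ℝ) := by positivity
  refine (measure_mono fun ω (hω : r ≤ _) => ?_).trans
    ((meas_ge_le_variance_div_sq hS hpos).trans (ENNReal.ofReal_le_ofReal ?_))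
  · rw [Set.mem_ofPred_eq, hmean, Finset.sum_apply, P.sum_cellSum T c]
    have e : c ⬝ᵥ P.empirical T N ω = P.empirical T N ω j := by simp [hc]
    rw [e, ← mul_sub, abs_mul, abs_of_pos hN']
    calc r * √(N : ℝ) ≤ √(N : ℝ) * |P.empirical T N ω j - P.prob θ₀ j| * √(N : ℝ) := by gcongr
      _ = √(N : ℝ) * √(N : ℝ) * |P.empirical T N ω j - P.prob θ₀ j| := by ring
      _ = _ := by rw [Real.mul_self_sqrt hN'.le]
  · rw [mul_pow, Real.sq_sqrt hN'.le, div_le_div_iff₀ (by positivity) (by positivity)]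
    nlinarith [sq_nonneg r]

/-- The standardized empirical frequencies are tight. -/
lemma measure_empirical_le (hθ₀ : θ₀ ∈ paramSpace)
    (hT : ∀ i, Measurable (T i)) (hindep : iIndepFun T μ)
    (hlaw : ∀ i s, μ.real {ω | T i ω ≤ s} = P.cdf θ₀ s) {r : ℝ} (hr : 0 < r) (N : ℕ) :
    μ {ω | r ≤ √(N : ℝ) * ‖P.empirical T N ω - P.prob θ₀‖} ≤
      (L + 1 : ℕ) * ENNReal.ofReal (1 / r ^ 2) := by
  have hsub : {ω | r ≤ √(N : ℝ) * ‖P.empirical T N ω - P.prob θ₀‖} ⊆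
      ⋃ j, {ω | r ≤ √(N : ℝ) * |P.empirical T N ω j - P.prob θ₀ j|} := by
    intro ω hω
    by_contra hcon
    simp only [Set.mem_iUnion, Set.mem_ofPred_eq, not_exists, not_le] at hcon hω
    refine absurd hω (not_le.2 ?_)
    have : ‖√(N : ℝ) • (P.empirical T N ω - P.prob θ₀)‖ < r := by
      rw [pi_norm_lt_iff hr]
      intro j
      simpa [abs_mul, abs_of_nonneg (Real.sqrt_nonneg _)] using hcon j
    rwa [norm_smul, Real.norm_of_nonneg (Real.sqrt_nonneg _)] at this
  refine (measure_mono hsub).trans ((measure_iUnion_le _).trans ?_)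
  rw [tsum_fintype]
  refine (Finset.sum_le_sum fun j _ =>
    measure_empirical_coord_le P hθ₀ hT hindep hlaw hr N j).trans ?_
  simp

/-- If `Z` is, near the true cell probabilities, a differentiable function of the empirical
frequencies up to a uniformly small error, then the error of its linearization is negligible. -/
lemma tendstoInMeasure_linearization (hθ₀ : θ₀ ∈ paramSpace)
    (hT : ∀ i, Measurable (T i)) (hindep : iIndepFun T μ)
    (hlaw : ∀ i s, μ.real {ω | T i ω ≤ s} = P.cdf θ₀ s) {Z : ℕ → Ω → ℝ} {c : Fin (L + 1) → ℝ}
    (hZ : ∀ ε > 0, ∃ δ > 0, ∀ N ω, ‖P.empirical T N ω - P.prob θ₀‖ < δ →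
      |Z N ω - c ⬝ᵥ (P.empirical T N ω - P.prob θ₀)| ≤ ε * ‖P.empirical T N ω - P.prob θ₀‖) :
    TendstoInMeasure μ ((fun (N : ℕ) ω => √(N : ℝ) * Z N ω) -
      fun (N : ℕ) ω => √(N : ℝ) * (c ⬝ᵥ (P.empirical T N ω - P.prob θ₀))) atTop 0 := by
  rw [tendstoInMeasure_iff_norm]
  intro η hη
  have hbound : Tendsto (fun r : ℝ => ((L + 1 : ℕ) : ENNReal) * ENNReal.ofReal (1 / r ^ 2)) atTop
      (𝓝 0) := by
    have h1 : Tendsto (fun r : ℝ => 1 / r ^ 2) atTop (𝓝 0) :=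
      tendsto_const_nhds.div_atTop (tendsto_pow_atTop two_ne_zero)
    have h2 := ENNReal.Tendsto.const_mul (a := ((L + 1 : ℕ) : ENNReal))
      (ENNReal.tendsto_ofReal h1) (Or.inr (ENNReal.natCast_ne_top _))
    simpa using h2
  rw [ENNReal.tendsto_nhds_zero]
  intro κ hκ
  obtain ⟨r, hrκ, hr⟩ := ((ENNReal.tendsto_nhds_zero.1 hbound κ hκ).and
    (eventually_gt_atTop 0)).exists
  -- Where `√N ‖p - π‖ < r`, the scaled error is at most `η / (2 r) * r = η / 2 < η`; `√N ≥ r / δ`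
  -- puts `p` within `δ` there.
  obtain ⟨δ, hδ, hZδ⟩ := hZ (η / (2 * r)) (by positivity)
  have hN : ∀ᶠ N : ℕ in atTop, r / δ ≤ √(N : ℝ) :=
    (Real.tendsto_sqrt_atTop.comp tendsto_natCast_atTop_atTop).eventually_ge_atTop _
  filter_upwards [hN] with N hN
  refine (measure_mono fun ω (hω : η ≤ _) => ?_).trans
    ((measure_empirical_le P hθ₀ hT hindep hlaw hr N).trans hrκ)
  rw [Set.mem_ofPred_eq]
  by_contra! hlt
  have hsq := Real.sqrt_nonneg (N : ℝ)
  have hsmall : ‖P.empirical T N ω - P.prob θ₀‖ < δ := by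
    by_contra! hge
    rw [div_le_iff₀ hδ] at hN
    have := mul_le_mul_of_nonneg_left hge hsq
    linarith
  have h1 := mul_le_mul_of_nonneg_left (hZδ N ω hsmall) hsq
  simp only [Pi.sub_apply, Pi.zero_apply, sub_zero, ← mul_sub, norm_mul, Real.norm_eq_abs,
    abs_of_nonneg hsq] at hω
  have h2 : √(N : ℝ) * (η / (2 * r) * ‖P.empirical T N ω - P.prob θ₀‖) ≤ η / (2 * r) * r := by
    rw [mul_left_comm]
    gcongr
  have h3 : η / (2 * r) * r = η / 2 := by field_simp
  linarith

end Probability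

/-- The asymptotic variance as the variance of a linear combination of cell indicators. -/
lemma meanLifetimeVariance_eq (hθ₀ : θ₀ ∈ paramSpace) (x₀ : ℝ) {c : Fin (L + 1) → ℝ}
    (hc : c = Matrix.vecMul (gradMeanLifetime x₀ θ₀).ofLp ((P.J β θ₀)⁻¹ * P.score β θ₀)) :
    meanLifetimeVariance P β x₀ θ₀ =
      (fun j => c j ^ 2) ⬝ᵥ P.prob θ₀ - (c ⬝ᵥ P.prob θ₀) ^ 2 := by
  set g := (gradMeanLifetime x₀ θ₀).ofLp with hg
  set S := P.score β θ₀ with hS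
  set B := (P.J β θ₀)⁻¹ * S with hBdef
  have hpos := P.prob_pos hθ₀
  have hJ : (P.J β θ₀)⁻¹.transpose = (P.J β θ₀)⁻¹ := by
    rw [Matrix.transpose_nonsing_inv]
    congr 1
    have := (P.J_posDef hθ₀ β).isHermitian
    rwa [Matrix.IsHermitian, Matrix.conjTranspose_eq_transpose_of_trivial] at this
  -- The middle factor of `K` is the covariance matrix `D_π - π πᵀ` of the cell indicators,
  -- multiplied by `D^{β-1}` on both sides.
  have hmid : Matrix.diagonal (fun j => P.prob θ₀ j ^ (2 * β - 1)) -
      Matrix.vecMulVec (fun j => P.prob θ₀ j ^ β) (fun j => P.prob θ₀ j ^ β) =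
      Matrix.diagonal (fun j => P.prob θ₀ j ^ (β - 1)) *
        (Matrix.diagonal (P.prob θ₀) - Matrix.vecMulVec (P.prob θ₀) (P.prob θ₀)) *
        Matrix.diagonal (fun j => P.prob θ₀ j ^ (β - 1)) := by
    ext i j
    rw [Matrix.mul_diagonal, Matrix.diagonal_mul]
    simp only [Matrix.sub_apply, Matrix.vecMulVec_apply]
    rw [← rpow_mul_rpow_sub_one (hpos i) β, ← rpow_mul_rpow_sub_one (hpos j) β]
    rcases eq_or_ne i j with rfl | hij
    · have e : P.prob θ₀ i ^ (2 * β - 1) =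
          P.prob θ₀ i * P.prob θ₀ i ^ (β - 1) * P.prob θ₀ i ^ (β - 1) := by
        rw [rpow_mul_rpow_sub_one (hpos i), ← Real.rpow_add (hpos i)]
        congr 1
        ring
      simp only [Matrix.diagonal_apply_eq]
      rw [e]
      ring
    · simp only [Matrix.diagonal_apply_ne _ hij]
      ring
  have hK : P.K β θ₀ =
      S * (Matrix.diagonal (P.prob θ₀) - Matrix.vecMulVec (P.prob θ₀) (P.prob θ₀)) *
        S.transpose := by
    rw [K, hmid, hS, score, Matrix.transpose_mul, Matrix.diagonal_transpose,
      Matrix.transpose_transpose]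
    simp only [Matrix.mul_assoc]
  have hc' : c = B.transpose.mulVec g := by
    rw [hc, Matrix.mulVec_transpose]
  have hB : (P.J β θ₀)⁻¹ * P.K β θ₀ * (P.J β θ₀)⁻¹ = B *
      ((Matrix.diagonal (P.prob θ₀) - Matrix.vecMulVec (P.prob θ₀) (P.prob θ₀)) *
        B.transpose) := by
    rw [hK, hBdef, Matrix.transpose_mul, hJ]
    simp only [Matrix.mul_assoc]
  clear_value B
  rw [meanLifetimeVariance, ← hg, hB, ← Matrix.mulVec_mulVec, ← Matrix.mulVec_mulVec, ← hc',
    Matrix.dotProduct_mulVec, ← hc, Matrix.sub_mulVec, dotProduct_sub]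
  congr 1
  · simp only [dotProduct, Matrix.mulVec_diagonal]
    exact Finset.sum_congr rfl fun j _ => by ring
  · have : (Matrix.vecMulVec (P.prob θ₀) (P.prob θ₀)).mulVec c =
        (P.prob θ₀ ⬝ᵥ c) • P.prob θ₀ := by
      ext i
      simp only [Matrix.mulVec, dotProduct, Matrix.vecMulVec_apply, Pi.smul_apply, smul_eq_mul,
        Finset.sum_mul]
      exact Finset.sum_congr rfl fun j _ => by ring
    rw [this, dotProduct_smul, dotProduct_comm (P.prob θ₀) c, smul_eq_mul, sq]

lemma measurable_meanLifetime (x₀ : ℝ) : Measurable (meanLifetime x₀) := by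
  have h : ∀ i : Fin 2, Measurable fun η : Param => η i := fun i =>
    (EuclideanSpace.proj i : Param →L[ℝ] ℝ).continuous.measurable
  exact ((h 0).const_div 1).mul ((h 1).mul_const x₀).neg.exp

end StepStress

/-- Asymptotic normality of the plug-in estimator of the mean lifetime at stress `x₀`. The
lifetimes `T i` are independent with the step-stress distribution function for the true parameter
`θ₀`; `θhat N` minimizes the divergence from the empirical probabilities of the first `N` devices
whenever a minimizer exists. -/
theorem theorem9 {k L : ℕ} (P : StepStress.Plan k L) (β : ℝ) (hβ : 0 ≤ β) (x₀ : ℝ)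
    (θ₀ : StepStress.Param) (hθ₀ : θ₀ ∈ StepStress.paramSpace)
    {Ω : Type*} [MeasurableSpace Ω] (μ : MeasureTheory.Measure Ω)
    [MeasureTheory.IsProbabilityMeasure μ]
    (T : ℕ → Ω → ℝ) (hT : ∀ i, Measurable (T i)) (hindep : ProbabilityTheory.iIndepFun T μ)
    (hlaw : ∀ i s, μ.real {ω | T i ω ≤ s} = P.cdf θ₀ s)
    (θhat : ℕ → Ω → StepStress.Param) (hmeas : ∀ N, AEMeasurable (θhat N) μ)
    (hmin : ∀ N ω, (∃ θ, StepStress.IsMDPDE P β (P.empirical T N ω) θ) →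
      StepStress.IsMDPDE P β (P.empirical T N ω) (θhat N ω)) :
    (∀ θ ∈ StepStress.paramSpace,
      ∫ s, s ∂(ProbabilityTheory.expMeasure (StepStress.rate θ x₀)) =
        StepStress.meanLifetime x₀ θ) ∧
    (∀ θ ∈ StepStress.paramSpace,
      HasGradientAt (StepStress.meanLifetime x₀) (StepStress.gradMeanLifetime x₀ θ) θ) ∧
    IsUnit (P.J β θ₀).det ∧
    0 ≤ StepStress.meanLifetimeVariance P β x₀ θ₀ ∧
    MeasureTheory.TendstoInDistribution
      (fun (N : ℕ) (ω : Ω) => √(N : ℝ) *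
        (StepStress.meanLifetime x₀ (θhat N ω) - StepStress.meanLifetime x₀ θ₀))
      Filter.atTop (id : ℝ → ℝ) (fun _ => μ)
      (ProbabilityTheory.gaussianReal 0
        (StepStress.meanLifetimeVariance P β x₀ θ₀).toNNReal) := by
  have hh := StepStress.hasFDerivAt_meanLifetime x₀ hθ₀
  have hvar := StepStress.meanLifetimeVariance_eq P hθ₀ x₀ (β := β) rfl
  have hclt := StepStress.tendstoInDistribution_dotProduct_empirical P hT hindep hlaw
    (Matrix.vecMul (StepStress.gradMeanLifetime x₀ θ₀).ofLp ((P.J β θ₀)⁻¹ * P.score β θ₀))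
  refine ⟨fun θ hθ => StepStress.integral_expMeasure_rate x₀ hθ,
    fun θ hθ => StepStress.hasGradientAt_meanLifetime x₀ hθ,
    (Matrix.isUnit_iff_isUnit_det _).1 (P.J_posDef hθ₀ β).isUnit, ?_, ?_⟩
  · rw [hvar, ← StepStress.variance_cellSum P (hT 0) (hlaw 0)]
    exact ProbabilityTheory.variance_nonneg _ _
  · rw [hvar]
    -- Slutsky: the estimator and its linearization differ by a term tending to zero in probability.
    refine MeasureTheory.tendstoInDistribution_of_tendstoInMeasure_sub _ _ hclt ?_ fun N => ?_
    · refine StepStress.tendstoInMeasure_linearization P hθ₀ hT hindep hlaw fun ε hε => ?_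
      obtain ⟨δ, hδ, hball⟩ := Metric.eventually_nhds_iff.1
        ((StepStress.eventually_exists_isMDPDE P hβ hθ₀).and
          (StepStress.eventually_isMDPDE_expansion P hβ hθ₀ hh hε))
      refine ⟨δ, hδ, fun N ω hω => ?_⟩
      obtain ⟨hex, hexp⟩ := hball (by rwa [dist_eq_norm])
      exact hexp _ (hmin N ω hex)
    · exact (((StepStress.measurable_meanLifetime x₀).comp_aemeasurable (hmeas N)).sub_const
        _).const_mul _
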